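/- Let $k\ge 1$ be an integer. For a finite set $A$ let $\omega\in\{\pm1\}^A$ be uniformly random, and for $\epsilon\in(0,1)$ let $\omega^\epsilon$ be obtained from $\omega$ by flipping the sign of each coordinate independently with probability $\epsilon$ (independently of $\omega$). A family of functions $f_n:\{\pm1\}^{A_n}\to\{\pm1\}$ is called noise stable if $\lim_{\epsilon\downarrow0}\sup_n \mathrm P\big(f_n(\omega)\ne f_n(\omega^\epsilon)\big)=0$. Tree-like graph. For $n\ge0$ let $G_n$ be the layered graph with nodes $v_{t,i}$, $0\le t\le n$, $|i|\le k(n-t)$, where for $t\ge1$ the children of $v_{t,i}$ are the $2k+1$ nodes $v_{t-1,j}$ with $|i-j|\le k$. Given $\omega\in\{\pm1\}^{\{-kn,\dots,kn\}}$, put $f(v_{0,j})=\omega(j)$, let $f(v_{t,i})$ for $t\ge1$ be the majority of the values of its children, and set $f_n(\omega)=f(v_{n,0})$. Cycle. For odd $n$ and $\omega_0=\omega\in\{\pm1\}^{\mathbb Z/n\mathbb Z}$ let $\omega_{t+1}(i)$ be the majority of the values $\omega_t(j)$ over the set of nodes $j\in\{i-k,\dots,i+k\}\bmod n$ (all $n$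 nodes if $n<2k+1$). For $T\ge 0$ let $g_{n,T}(\omega)$ be the majority of the $n$ values $\omega_T(i)$, $i\in\mathbb Z/n\mathbb Z$. Theorem (convolutional iterated $(2k+1)$-majority with stride $1$ is noise stable, with and without cyclical convention). The sequence $(f_n)_{n\ge0}$ is noise stable, and for every choice of depths $T_n\in\{0,1,2,\dots\}$ the sequence $(g_{n,T_n})_{n\text{ odd}}$ is noise stable. -/

import Mathlib

open Filter Topology MeasureTheory
open scoped ENNReal

/-- Majority of the `±1`-values `x i`, `i ∈ s`: the sign of their sum. It is only ever applied to
sets `s` of odd cardinality, for which the sum is never zero. -/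
def majorityOn {α : Type} (s : Finset α) (x : α → ℤˣ) : ℤˣ :=
  if 0 < ∑ i ∈ s, ((x i : ℤˣ) : ℤ) then 1 else -1

/-! ### Noise stability -/

instance signMeasurableSingletonClass : MeasurableSingletonClass ℤˣ where
  measurableSet_singleton u := ⟨{(u : ℤ)}, MeasurableSet.of_discrete, by
    ext v; simp [Units.ext_iff]⟩

/-- The law on `{1, -1}` giving mass `p` to `-1` and mass `1 - p` to `1`. -/
noncomputable def signLaw (p : ℝ) : Measure ℤˣ :=
  ENNReal.ofReal (1 - p) • Measure.dirac 1 + ENNReal.ofReal p • Measure.dirac (-1)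

/-- Joint law of a uniform vector `ω ∈ {±1}^α` and an independent vector `η` whose coordinates are
independent and equal to `-1` with probability `ε`. The noisy version of `ω` is the coordinatewise
product `ω * η`, in which each bit of `ω` is flipped independently with probability `ε`. -/
noncomputable def noiseLaw (α : Type) [Fintype α] (ε : ℝ) : Measure ((α → ℤˣ) × (α → ℤˣ)) :=
  (Measure.pi fun _ : α => signLaw (1 / 2)).prod (Measure.pi fun _ : α => signLaw ε)

/-- `P(f(ω) ≠ f(ω^ε))`. -/
noncomputable def disagreement {α : Type} [Fintype α] (f : (α → ℤˣ) → ℤˣ) (ε : ℝ) : ℝ≥0∞ :=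
  noiseLaw α ε {p | f p.1 ≠ f (p.1 * p.2)}

/-- A family of Boolean functions `f n : {±1}^(α n) → {±1}` is noise stable if
`lim_{ε → 0} sup_n P(f n (ω) ≠ f n (ω^ε)) = 0`. -/
def NoiseStable {ι : Type} {α : ι → Type} [∀ n, Fintype (α n)]
    (f : (n : ι) → (α n → ℤˣ) → ℤˣ) : Prop :=
  Tendsto (fun ε : ℝ => ⨆ n, disagreement (f n) ε) (𝓝[>] 0) (𝓝 0)

/-! ### The tree-like graph with stride one -/

/-- The layer `m` generations below the output node: the nodes `-km, …, km`. -/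
abbrev TreeLayer (k m : ℕ) : Type := {i : ℤ // i ∈ Finset.Icc (-((k : ℤ) * m)) ((k : ℤ) * m)}

/-- The children of node `i` are the nodes `j` of the layer below with `|i - j| ≤ k`. -/
noncomputable def treeChildren (k m : ℕ) (i : TreeLayer k m) : Finset (TreeLayer k (m + 1)) :=
  Finset.univ.filter fun j => ((i : ℤ) - (j : ℤ)).natAbs ≤ k

/-- The function computed by the network with `n` layers above its input layer `-kn, …, kn`:
every node takes the majority of its `2k+1` children, and the value of the single top node is
the output. -/
noncomputable def treeMajority (k : ℕ) : (n : ℕ) → (TreeLayer k n → ℤˣ) → ℤˣ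
  | 0, ω => ω ⟨0, by simp⟩
  | n + 1, ω => treeMajority k n fun i => majorityOn (treeChildren k n i) ω

/-! ### The cycle with stride one -/

/-- The children of node `i` of the `n`-cycle are the nodes `i - k, …, i + k` modulo `n`. -/
noncomputable def cycleChildren (k n : ℕ) (i : ZMod n) : Finset (ZMod n) :=
  (Finset.Icc (-(k : ℤ)) (k : ℤ)).image fun d : ℤ => i + (d : ZMod n)

/-- One layer of the network on the `n`-cycle. -/
noncomputable def cycleStep (k n : ℕ) (ω : ZMod n → ℤˣ) : ZMod n → ℤˣ :=
  fun i => majorityOn (cycleChildren k n i) ω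

/-- The function computed on the `n`-cycle: `T` layers of `2k+1`-majorities, followed by the
majority of all `n` values in the last layer. -/
noncomputable def cycleMajority (k T n : ℕ) [NeZero n] (ω : ZMod n → ℤˣ) : ℤˣ :=
  majorityOn Finset.univ ((cycleStep k n)^[T] ω)

instance oddNeZero (n : {n : ℕ // Odd n}) : NeZero (n : ℕ) := ⟨n.2.pos.ne'⟩

/-!
Once `k + 1` consecutive sites agree, each of them sees a majority of that block at every later
time, so the block never changes and no information crosses it. With probability close to one a
site has such blocks on both sides within bounded distance, hence its value at any time depends on
boundedly many inputs. For the tree-like graph, a piece of the automaton on `ℤ`, this is already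
noise stability.

On the cycle let `S` be the sum of the final values and `D` the change of `S` caused by the noise.
If the majority changes then `|S| ≤ |D|`. The changes at two distant sites are almost
uncorrelated, so the variance of `D` is at most a small multiple of `n` when few sites are flipped.
On the other hand `S` is spread over the scale `√n`: typically there are linearly many disjoint
triples of adjacent constant blocks, and reversing the middle block of such a triple at time `0`
reverses it at all times and changes nothing else. Given everything but these reversals, `S` is
thus a constant plus a multiple of a sum of order `n` independent signs. So `|S| ≤ |D|` is
unlikely.
-/

/-! ### Majorities -/

section Majority

variable {α β : Type} {s t : Finset α} {x y : α → ℤˣ}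

theorem abs_signSum_le_card (s : Finset α) (x : α → ℤˣ) : |∑ i ∈ s, (x i : ℤ)| ≤ s.card := by
  simpa [Int.isUnit_iff_abs_eq.mp (x _).isUnit] using
    Finset.abs_sum_le_sum_abs (fun i => (x i : ℤ)) s

theorem majorityOn_congr (h : ∀ i ∈ s, x i = y i) : majorityOn s x = majorityOn s y := by
  unfold majorityOn
  rw [Finset.sum_congr rfl fun i hi => by rw [h i hi]]

theorem majorityOn_image [DecidableEq β] {g : α → β} (hg : Set.InjOn g s) (x : β → ℤˣ) :
    majorityOn (s.image g) x = majorityOn s (x ∘ g) := by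
  simp only [majorityOn, Finset.sum_image hg, Function.comp_apply]

theorem majorityOn_eq_of_subset {u : ℤˣ} (hts : t ⊆ s) (hcard : s.card < 2 * t.card)
    (hx : ∀ i ∈ t, x i = u) : majorityOn s x = u := by
  classical
  have hsum : ∑ i ∈ s, (x i : ℤ) = ∑ i ∈ s \ t, (x i : ℤ) + t.card * (u : ℤ) := by
    rw [← Finset.sum_sdiff hts, Finset.sum_congr (s₁ := t) rfl fun i hi => by rw [hx i hi],
      Finset.sum_const, nsmul_eq_mul]
  have hc : (s \ t).card + t.card = s.card := Finset.card_sdiff_add_card_eq_card hts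
  have hrest := abs_le.mp (abs_signSum_le_card (s \ t) x)
  rw [majorityOn, hsum]
  rcases Int.units_eq_one_or u with rfl | rfl
  · rw [if_pos]; simp only [Units.val_one]; omega
  · rw [if_neg]; simp only [Units.val_neg, Units.val_one]; omega

theorem abs_signSum_le_of_majorityOn_ne (h : majorityOn s x ≠ majorityOn s y) :
    |∑ i ∈ s, (x i : ℤ)| ≤ |∑ i ∈ s, ((x i : ℤ) - y i)| := by
  rw [Finset.sum_sub_distrib]
  unfold majorityOn at h
  split_ifs at h
  · exact absurd rfl h
  · rw [abs_of_pos ‹_›, abs_of_pos (by omega)]; omega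
  · rw [abs_of_nonpos (by omega), abs_of_nonpos (by omega)]; omega
  · exact absurd rfl h

end Majority

/-! ### Majority automata -/

/-- The majority automaton with neighbourhoods `N`: at each step, every site adopts the majority
value of its neighbourhood. -/
noncomputable def majorityStep {V : Type} (N : V → Finset V) (ω : V → ℤˣ) : V → ℤˣ :=
  fun v => majorityOn (N v) ω

/-- A set of sites is self-supporting if it contains more than half of the neighbourhood of each
of its members, so that once constant it never changes. -/
def SelfSupporting {V : Type} [DecidableEq V] (N : V → Finset V) (B : Finset V) : Prop :=
  ∀ v ∈ B, (N v).card < 2 * (N v ∩ B).card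

section Automaton

variable {V V' : Type} [DecidableEq V] {N : V → Finset V} {N' : V' → Finset V'} {B : Finset V}
  {ω ω' σ : V → ℤˣ}

theorem SelfSupporting.iterate_eq (hB : SelfSupporting N B) {u : ℤˣ} (hω : ∀ v ∈ B, ω v = u)
    (T : ℕ) : ∀ v ∈ B, (majorityStep N)^[T] ω v = u := by
  induction T with
  | zero => exact hω
  | succ T ih =>
    intro v hv
    rw [Function.iterate_succ_apply']
    exact majorityOn_eq_of_subset Finset.inter_subset_left (hB v hv) fun w hw =>
      ih w (Finset.mem_of_mem_inter_right hw)

theorem eqOn_iterate_majorityStep {W : Set V} (hωω' : Set.EqOn ω ω' W)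
    (hW : ∀ v ∈ W, (∃ B : Finset V, v ∈ B ∧ ↑B ⊆ W ∧ SelfSupporting N B ∧
      ∃ u, ∀ w ∈ B, ω w = u) ∨ ↑(N v) ⊆ W) (T : ℕ) :
    Set.EqOn ((majorityStep N)^[T] ω) ((majorityStep N)^[T] ω') W := by
  induction T with
  | zero => exact hωω'
  | succ T ih =>
    intro v hv
    obtain ⟨B, hvB, hBW, hB, u, hu⟩ | hNW := hW v hv
    · have hu' : ∀ w ∈ B, ω' w = u := fun w hw => (hωω' (hBW hw)).symm.trans (hu w hw)
      rw [hB.iterate_eq hu _ v hvB, hB.iterate_eq hu' _ v hvB]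
    · simp only [Function.iterate_succ_apply']
      exact majorityOn_congr fun w hw => ih (hNW hw)

theorem iterate_majorityStep_mul
    (hσ : ∀ v, (∃ B : Finset V, v ∈ B ∧ SelfSupporting N B ∧ (∃ u, ∀ w ∈ B, ω w = u) ∧
      ∃ s, ∀ w ∈ B, σ w = s) ∨ σ v = 1 ∧ ∀ w ∈ N v, σ w = 1) (T : ℕ) :
    (majorityStep N)^[T] (σ * ω) = σ * (majorityStep N)^[T] ω := by
  induction T with
  | zero => rfl
  | succ T ih =>
    funext v
    obtain ⟨B, hvB, hB, ⟨u, hu⟩, s, hs⟩ | ⟨hv, hNv⟩ := hσ v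
    · have hsu : ∀ w ∈ B, (σ * ω) w = s * u := fun w hw => by rw [Pi.mul_apply, hs w hw, hu w hw]
      rw [Pi.mul_apply, hB.iterate_eq hsu _ v hvB, hB.iterate_eq hu _ v hvB, hs v hvB]
    · rw [Pi.mul_apply, hv, one_mul, Function.iterate_succ_apply', Function.iterate_succ_apply', ih]
      exact majorityOn_congr fun w hw => by rw [Pi.mul_apply, hNv w hw, one_mul]

theorem SelfSupporting.image [DecidableEq V'] {φ : V' → V} {B : Finset V'}
    (hB : SelfSupporting N' B) (hφ : ∀ v ∈ B, N (φ v) = (N' v).image φ) (hinj : Set.InjOn φ B) :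
    SelfSupporting N (B.image φ) := by
  simp only [SelfSupporting, Finset.forall_mem_image]
  intro v hv
  have hinter : (N' v ∩ B).card ≤ (N (φ v) ∩ B.image φ).card := by
    rw [← Finset.card_image_of_injOn (hinj.mono (Finset.coe_subset.mpr Finset.inter_subset_right)),
      hφ v hv]
    exact Finset.card_le_card (Finset.image_inter_subset φ (N' v) B)
  calc (N (φ v)).card ≤ (N' v).card := by rw [hφ v hv]; exact Finset.card_image_le
    _ < 2 * (N' v ∩ B).card := hB v hv
    _ ≤ 2 * (N (φ v) ∩ B.image φ).card := Nat.mul_le_mul_left 2 hinter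

theorem iterate_majorityStep_comp {φ : V' → V} (hinj : ∀ v, Set.InjOn φ (N' v))
    (hφ : ∀ v, N (φ v) = (N' v).image φ) (ω : V → ℤˣ) (T : ℕ) :
    (majorityStep N')^[T] (ω ∘ φ) = (majorityStep N)^[T] ω ∘ φ := by
  refine (Function.Semiconj.iterate_right (f := (· ∘ φ)) (fun ω => funext fun v => ?_) T ω).symm
  simp only [majorityStep, Function.comp_apply, hφ, majorityOn_image (hinj v)]

end Automaton

/-! ### The automaton on the line -/

/-- The `2k+1`-majority automaton on `ℤ`, of which the tree-like graph and the cycle are finite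
pieces. -/
noncomputable def lineStep (k : ℕ) : (ℤ → ℤˣ) → ℤ → ℤˣ :=
  majorityStep fun i => Finset.Icc (i - k) (i + k)

/-- `ζ` is constant on the `k + 1` consecutive sites starting at `a`. -/
def ConstBlock (k : ℕ) (ζ : ℤ → ℤˣ) (a : ℤ) : Prop :=
  ∀ x ∈ Finset.Icc a (a + k), ζ x = ζ a

/-- Some block on either side of the origin, within distance `L`, is constant. Since constant
blocks never change, the origin is then cut off from all sites at distance more than `L`. -/
def Shielded (k L : ℕ) (ζ : ℤ → ℤˣ) : Prop :=
  (∃ a : ℤ, -L ≤ a ∧ a + k ≤ 0 ∧ ConstBlock k ζ a) ∧ ∃ b : ℤ, 0 ≤ b ∧ b + k ≤ L ∧ ConstBlock k ζ b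

section Line

variable {k L : ℕ} {ζ ξ : ℤ → ℤˣ}

theorem selfSupporting_Icc (k : ℕ) (a : ℤ) :
    SelfSupporting (fun i : ℤ => Finset.Icc (i - k) (i + k)) (Finset.Icc a (a + k)) := by
  intro x hx
  have hsub : Finset.Icc a (a + k) ⊆ Finset.Icc (x - k) (x + k) := by
    rw [Finset.mem_Icc] at hx
    exact Finset.Icc_subset_Icc (by omega) (by omega)
  rw [Finset.inter_eq_right.mpr hsub, Int.card_Icc, Int.card_Icc]
  omega

theorem Shielded.iterate_congr (h : Shielded k L ζ) (hζ : Set.EqOn ζ ξ (Set.Icc (-L) L)) (T : ℕ) :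
    (lineStep k)^[T] ζ 0 = (lineStep k)^[T] ξ 0 := by
  obtain ⟨⟨a, haL, ha, hA⟩, b, hb, hbL, hB⟩ := h
  refine eqOn_iterate_majorityStep (W := Set.Icc a (b + k))
    (hζ.mono (Set.Icc_subset_Icc (by omega) (by omega))) ?_ T ⟨by omega, by omega⟩
  rintro x ⟨hax, hxb⟩
  have block (c : ℤ) (hac : a ≤ c) (hcb : c ≤ b) (hC : ConstBlock k ζ c) (hcx : c ≤ x)
      (hxc : x ≤ c + k) : ∃ B : Finset ℤ, x ∈ B ∧ ↑B ⊆ Set.Icc a (b + k) ∧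
        SelfSupporting (fun i : ℤ => Finset.Icc (i - k) (i + k)) B ∧ ∃ u, ∀ w ∈ B, ζ w = u := by
    refine ⟨_, Finset.mem_Icc.mpr ⟨hcx, hxc⟩, ?_, selfSupporting_Icc k c, ζ c, hC⟩
    rw [Finset.coe_Icc]
    exact Set.Icc_subset_Icc hac (by omega)
  by_cases hxa : x ≤ a + k
  · exact Or.inl (block a le_rfl (by omega) hA hax hxa)
  by_cases hbx : b ≤ x
  · exact Or.inl (block b (by omega) le_rfl hB hbx hxb)
  · rw [Finset.coe_Icc]
    exact Or.inr (Set.Icc_subset_Icc (by omega) (by omega))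

end Line

/-! ### The tree-like graph and the cycle as pieces of the line -/

theorem treeMajority_restrict (k n : ℕ) (ζ : ℤ → ℤˣ) :
    treeMajority k n (fun i => ζ i) = (lineStep k)^[n] ζ 0 := by
  induction n generalizing ζ with
  | zero => rfl
  | succ n ih =>
    rw [Function.iterate_succ_apply, ← ih, treeMajority]
    congr 1
    funext i
    have hchildren : (treeChildren k n i).image Subtype.val = Finset.Icc ((i : ℤ) - k) (i + k) := by
      ext x
      have hi := Finset.mem_Icc.mp i.2
      simp only [Finset.mem_Icc, treeChildren, Finset.mem_image, Finset.mem_filter,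
        Finset.mem_univ, true_and, Subtype.exists, exists_and_right, exists_eq_right]
      push_cast
      exact ⟨fun ⟨_, _⟩ => by omega, fun hx => ⟨⟨by linarith, by linarith⟩, by omega⟩⟩
    rw [lineStep, majorityStep, ← hchildren, majorityOn_image Subtype.val_injective.injOn]
    rfl

theorem injOn_add_intCast {n : ℕ} {a b : ℤ} (h : b - a < n) (i : ZMod n) :
    Set.InjOn (fun d : ℤ => i + d) (Set.Icc a b) := by
  intro x hx y hy hxy
  have hdvd := (ZMod.intCast_eq_intCast_iff_dvd_sub x y n).mp (add_left_cancel hxy)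
  have := Int.eq_zero_of_abs_lt_dvd hdvd (by rw [abs_lt]; grind)
  omega

theorem cycleChildren_add_intCast (k n : ℕ) (i : ZMod n) (x : ℤ) : cycleChildren k n (i + x) =
    (Finset.Icc (x - k) (x + k)).image fun s : ℤ => i + (s : ZMod n) := by
  have hshift : Finset.Icc (x - k) (x + k) = (Finset.Icc (-(k : ℤ)) k).image (x + ·) := by
    rw [Finset.image_add_left_Icc]; rfl
  rw [hshift, Finset.image_image, cycleChildren]
  exact Finset.image_congr fun d _ => by simp [add_assoc]

theorem iterate_cycleStep_eq_lineStep {k n : ℕ} (hn : 2 * k < n) (T : ℕ) (ω : ZMod n → ℤˣ)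
    (i : ZMod n) : (cycleStep k n)^[T] ω i = (lineStep k)^[T] (ω ∘ fun s : ℤ => i + s) 0 := by
  have hcomp := congrFun (iterate_majorityStep_comp (N' := fun x : ℤ => Finset.Icc (x - k) (x + k))
    (N := cycleChildren k n) (φ := fun s : ℤ => i + s)
    (fun x => by rw [Finset.coe_Icc]; exact injOn_add_intCast (by omega) i)
    (cycleChildren_add_intCast k n i) ω T) 0
  simp only [Function.comp_apply, Int.cast_zero, add_zero] at hcomp
  exact hcomp.symm

/-! ### Uniform sign vectors -/

open ProbabilityTheory in
theorem indepFun_pi_of_dependsOn {ι β γ : Type*} [Fintype ι] {Ω : ι → Type*}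
    [∀ i, MeasurableSpace (Ω i)] [∀ i, Finite (Ω i)] [∀ i, MeasurableSingletonClass (Ω i)]
    {μ : ∀ i, Measure (Ω i)} [∀ i, IsProbabilityMeasure (μ i)] [MeasurableSpace β]
    [MeasurableSpace γ] {F : (∀ i, Ω i) → β} {G : (∀ i, Ω i) → γ} {S T : Finset ι}
    (hF : DependsOn F S) (hG : DependsOn G T) (hST : Disjoint S T) :
    IndepFun F G (Measure.pi μ) := by
  obtain ⟨ω⟩ := nonempty_of_isProbabilityMeasure (Measure.pi μ)
  have : Nonempty β := ⟨F ω⟩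
  have : Nonempty γ := ⟨G ω⟩
  obtain ⟨F', rfl⟩ := dependsOn_iff_exists_comp.mp hF
  obtain ⟨G', rfl⟩ := dependsOn_iff_exists_comp.mp hG
  have hcoord : iIndepFun (fun i (ω : ∀ i, Ω i) => ω i) (Measure.pi μ) :=
    iIndepFun_pi (X := fun _ => id) fun _ => aemeasurable_id
  exact (hcoord.indepFun_finset S T hST measurable_pi_apply).comp
    (measurable_of_finite F') (measurable_of_finite G')

theorem isProbabilityMeasure_signLaw {p : ℝ} (h0 : 0 ≤ p) (h1 : p ≤ 1) :
    IsProbabilityMeasure (signLaw p) := by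
  refine ⟨?_⟩
  simp only [signLaw, Measure.coe_add, Measure.coe_smul, Pi.add_apply, Pi.smul_apply, measure_univ,
    smul_eq_mul, mul_one]
  rw [← ENNReal.ofReal_add (by linarith) h0, sub_add_cancel, ENNReal.ofReal_one]

instance isProbabilityMeasure_signLaw_half : IsProbabilityMeasure (signLaw (1 / 2)) :=
  isProbabilityMeasure_signLaw (by norm_num) (by norm_num)

theorem signLaw_singleton_neg_one (p : ℝ) : signLaw p {-1} = ENNReal.ofReal p := by
  simp [signLaw, show (1 : ℤˣ) ≠ -1 by decide]

theorem signLaw_singleton_one (p : ℝ) : signLaw p {1} = ENNReal.ofReal (1 - p) := by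
  simp [signLaw, show (-1 : ℤˣ) ≠ 1 by decide]

theorem signLaw_half_singleton (u : ℤˣ) : signLaw (1 / 2) {u} = ENNReal.ofReal (1 / 2) := by
  rcases Int.units_eq_one_or u with rfl | rfl
  · rw [signLaw_singleton_one, sub_half]
  · exact signLaw_singleton_neg_one _

/-- The uniform distribution on `{±1}^α`. -/
noncomputable def fairSigns (α : Type) [Fintype α] : Measure (α → ℤˣ) :=
  Measure.pi fun _ => signLaw (1 / 2)

section FairSigns

variable {α : Type} [Fintype α]

instance isProbabilityMeasure_fairSigns : IsProbabilityMeasure (fairSigns α) :=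
  inferInstanceAs (IsProbabilityMeasure (Measure.pi fun _ => signLaw (1 / 2)))

theorem measurePreserving_fairSigns (e : (α → ℤˣ) ≃ (α → ℤˣ)) :
    MeasurePreserving e (fairSigns α) (fairSigns α) := by
  refine ⟨.of_discrete, Measure.ext_of_singleton fun ω => ?_⟩
  have hpre : e ⁻¹' {ω} = {e.symm ω} := by
    ext ω'
    exact e.eq_symm_apply.symm
  rw [Measure.map_apply .of_discrete .of_discrete, hpre]
  simp only [fairSigns, Measure.pi_singleton, signLaw_half_singleton]

theorem measurePreserving_mul_right_fairSigns (η : α → ℤˣ) :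
    MeasurePreserving (· * η) (fairSigns α) (fairSigns α) :=
  measurePreserving_fairSigns (Equiv.mulRight η)

theorem fairSigns_real_forall_eq (s : Finset α) (u : α → ℤˣ) :
    (fairSigns α).real {ω | ∀ x ∈ s, ω x = u x} = (1 / 2) ^ s.card := by
  classical
  have hpi : {ω : α → ℤˣ | ∀ x ∈ s, ω x = u x} =
      Set.univ.pi fun x => if x ∈ s then {u x} else Set.univ := by
    ext ω
    refine forall_congr' fun x => ?_
    by_cases hx : x ∈ s <;> simp [hx]
  have hmass (x : α) : signLaw (1 / 2) (if x ∈ s then {u x} else Set.univ) =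
      if x ∈ s then ENNReal.ofReal (1 / 2) else 1 := by
    split_ifs
    exacts [signLaw_half_singleton _, measure_univ]
  rw [Measure.real, hpi, fairSigns, Measure.pi_pi, Finset.prod_congr rfl fun x _ => hmass x]
  simp

theorem fairSigns_real_biInter {ι : Type*} {J : Finset ι} {E : ι → Set (α → ℤˣ)}
    {S : ι → Finset α} (hE : ∀ j ∈ J, DependsOn (· ∈ E j) (S j : Set α))
    (hS : (J : Set ι).PairwiseDisjoint S) :
    (fairSigns α).real (⋂ j ∈ J, E j) = ∏ j ∈ J, (fairSigns α).real (E j) := by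
  classical
  induction J using Finset.induction_on with
  | empty => simp
  | insert i J hi ih =>
    rw [Finset.coe_insert, Set.pairwiseDisjoint_insert_of_notMem hi] at hS
    have hinter : DependsOn (· ∈ ⋂ j ∈ J, E j) (J.biUnion S : Set α) := fun ω ω' h => by
      simp only [Set.mem_iInter]
      refine propext (forall₂_congr fun j hj => ?_)
      exact iff_of_eq (hE j (Finset.mem_insert_of_mem hj) fun x hx =>
        h x (Finset.mem_biUnion.mpr ⟨j, hj, hx⟩))
    have hindep : ProbabilityTheory.IndepFun (· ∈ E i) (· ∈ ⋂ j ∈ J, E j) (fairSigns α) :=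
      indepFun_pi_of_dependsOn (hE i (Finset.mem_insert_self i J)) hinter
        ((Finset.disjoint_biUnion_right _ _ _).mpr hS.2)
    have hmul := hindep.measure_inter_preimage_eq_mul {True} {True} .of_discrete .of_discrete
    rw [Finset.set_biInter_insert, Finset.prod_insert hi,
      ← ih (fun j hj => hE j (Finset.mem_insert_of_mem hj)) hS.1, Measure.real, Measure.real,
      Measure.real, ← ENNReal.toReal_mul]
    congr 1
    simpa only [Set.preimage, Set.mem_singleton_iff, eq_iff_iff, iff_true,
      Set.ofPred_mem_eq] using hmul

end FairSigns

/-! ### Noise -/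

section Noise

variable {α : Type} [Fintype α]

/-- The number of sites of `s` flipped by the noise vector `η`. -/
def flipCount {α : Type} (s : Finset α) (η : α → ℤˣ) : ℕ :=
  (s.filter (η · = -1)).card

/-- The probability that multiplying a uniform sign vector by the fixed vector `η` changes the
value of `f`. -/
noncomputable def changeProb (f : (α → ℤˣ) → ℤˣ) (η : α → ℤˣ) : ℝ :=
  (fairSigns α).real {ω | f ω ≠ f (ω * η)}

theorem changeProb_nonneg (f : (α → ℤˣ) → ℤˣ) (η : α → ℤˣ) : 0 ≤ changeProb f η :=
  measureReal_nonneg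

theorem integral_flipCount (s : Finset α) {ε : ℝ} (h0 : 0 ≤ ε) (h1 : ε ≤ 1) :
    ∫ η, (flipCount s η : ℝ) ∂Measure.pi (fun _ : α => signLaw ε) = ε * s.card := by
  have := isProbabilityMeasure_signLaw h0 h1
  have hcount (η : α → ℤˣ) :
      (flipCount s η : ℝ) = ∑ x ∈ s, {η : α → ℤˣ | η x = -1}.indicator 1 η := by
    simp [flipCount, Set.indicator_apply, Finset.sum_boole]
  have hmass (x : α) : (Measure.pi fun _ : α => signLaw ε).real {η | η x = -1} = ε := by
    have hx := (measurePreserving_eval (fun _ : α => signLaw ε) x).measure_preimage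
      (s := {-1}) (MeasurableSet.singleton _).nullMeasurableSet
    rw [signLaw_singleton_neg_one] at hx
    exact (congrArg ENNReal.toReal hx).trans (ENNReal.toReal_ofReal h0)
  simp only [hcount]
  rw [integral_finsetSum _ fun _ _ => .of_finite]
  simp only [integral_indicator_one (MeasurableSet.of_discrete), hmass, Finset.sum_const,
    nsmul_eq_mul, mul_comm]

theorem disagreement_le {f : (α → ℤˣ) → ℤˣ} {ε a b : ℝ} {s : Finset α} (h0 : 0 ≤ ε) (h1 : ε ≤ 1)
    (hf : ∀ η, changeProb f η ≤ a + b * flipCount s η) :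
    disagreement f ε ≤ ENNReal.ofReal (a + b * s.card * ε) := by
  have := isProbabilityMeasure_signLaw h0 h1
  calc disagreement f ε
      = ∫⁻ η, ENNReal.ofReal (changeProb f η) ∂Measure.pi fun _ : α => signLaw ε := by
        rw [disagreement, noiseLaw, Measure.prod_apply_symm .of_discrete]
        exact lintegral_congr fun η => (ofReal_measureReal (μ := fairSigns α)).symm
    _ = ENNReal.ofReal (∫ η, changeProb f η ∂Measure.pi fun _ : α => signLaw ε) :=
        (ofReal_integral_eq_lintegral_ofReal .of_finite
          (ae_of_all _ fun _ => measureReal_nonneg)).symm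
    _ ≤ ENNReal.ofReal (∫ η, (a + b * flipCount s η) ∂Measure.pi fun _ : α => signLaw ε) :=
        ENNReal.ofReal_le_ofReal (integral_mono .of_finite .of_finite hf)
    _ = ENNReal.ofReal (a + b * s.card * ε) := by
        rw [integral_add .of_finite .of_finite, integral_const_mul, integral_flipCount s h0 h1,
          integral_const, probReal_univ, one_smul, mul_assoc, mul_comm ε]

theorem changeProb_le_add_flipCount {f : (α → ℤˣ) → ℤˣ} {s : Finset α} {η : α → ℤˣ} {a : ℝ}
    (ha : 0 ≤ a) (hf : (∀ x ∈ s, η x = 1) → changeProb f η ≤ a) :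
    changeProb f η ≤ a + flipCount s η := by
  by_cases hη : ∀ x ∈ s, η x = 1
  · exact (hf hη).trans (le_add_of_nonneg_right (Nat.cast_nonneg _))
  · push Not at hη
    obtain ⟨x, hx, hηx⟩ := hη
    have hpos : 1 ≤ flipCount s η := Finset.card_pos.mpr
      ⟨x, Finset.mem_filter.mpr ⟨hx, (Int.units_eq_one_or _).resolve_left hηx⟩⟩
    calc changeProb f η ≤ 1 := measureReal_le_one
      _ ≤ a + flipCount s η := by
        have : (1 : ℝ) ≤ flipCount s η := by exact_mod_cast hpos
        linarith

end Noise

theorem noiseStable_of_changeProb_le {ι : Type} {α : ι → Type} [∀ n, Fintype (α n)]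
    {f : (n : ι) → (α n → ℤˣ) → ℤˣ}
    (h : ∀ a > 0, ∃ C : ℝ, ∀ n, ∃ (s : Finset (α n)) (b : ℝ), b * s.card ≤ C ∧
      ∀ η, changeProb (f n) η ≤ a + b * flipCount s η) : NoiseStable f := by
  rw [NoiseStable, ENNReal.tendsto_nhds_zero]
  intro δ hδ
  obtain ⟨a, ha, haδ⟩ : ∃ a : ℝ, 0 < a ∧ ENNReal.ofReal a < δ := by
    obtain ⟨q, hq, hqδ⟩ := ENNReal.lt_iff_exists_nnreal_btwn.1 hδ
    exact ⟨q, by exact_mod_cast hq, by simpa using hqδ⟩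
  obtain ⟨C, hC⟩ := h (a / 2) (half_pos ha)
  have hlim : Tendsto (fun ε : ℝ => a / 2 + C * ε) (𝓝[>] 0) (𝓝 (a / 2)) := by
    have hcont : Continuous fun ε : ℝ => a / 2 + C * ε := by fun_prop
    simpa using (hcont.tendsto 0).mono_left nhdsWithin_le_nhds
  filter_upwards [hlim.eventually_lt_const (half_lt_self ha), Ioc_mem_nhdsGT one_pos]
    with ε hε ⟨hε0, hε1⟩
  refine iSup_le fun n => ?_
  obtain ⟨s, b, hbs, hb⟩ := hC n
  calc disagreement (f n) ε ≤ ENNReal.ofReal (a / 2 + b * s.card * ε) :=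
        disagreement_le hε0.le hε1 hb
    _ ≤ ENNReal.ofReal a := ENNReal.ofReal_le_ofReal
        ((add_le_add_right (mul_le_mul_of_nonneg_right hbs hε0.le) _).trans hε.le)
    _ ≤ δ := haδ.le

/-! ### Shielding is likely -/

/-- Bound on the probability that the origin is not shielded within distance `L`: on either side
there are `L / (k + 1)` disjoint blocks, each constant with probability at least
`(1 / 2) ^ (k + 1)`. -/
noncomputable def shieldBound (k L : ℕ) : ℝ :=
  2 * (1 - (1 / 2) ^ (k + 1)) ^ (L / (k + 1))

section ShieldBound

variable (k L : ℕ)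

theorem one_sub_half_pow_mem : 0 ≤ 1 - (1 / 2 : ℝ) ^ (k + 1) ∧ 1 - (1 / 2 : ℝ) ^ (k + 1) < 1 :=
  ⟨sub_nonneg.mpr (pow_le_one₀ (by norm_num) (by norm_num)), sub_lt_self _ (by positivity)⟩

theorem shieldBound_nonneg : 0 ≤ shieldBound k L :=
  mul_nonneg zero_le_two (pow_nonneg (one_sub_half_pow_mem k).1 _)

theorem summable_pow_div {ρ : ℝ} (h0 : 0 ≤ ρ) (h1 : ρ < 1) (c : ℕ) [NeZero c] :
    Summable fun d : ℕ => ρ ^ (d / c) := by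
  rw [← (Nat.divModEquiv c).symm.summable_iff]
  have hprod := (summable_geometric_of_lt_one h0 h1).mul_of_nonneg
    (Summable.of_finite (f := fun _ : Fin c => (1 : ℝ))) (fun q => pow_nonneg h0 q)
    fun _ => zero_le_one
  have hdiv (p : ℕ × Fin c) : (Nat.divModEquiv c).symm p / c = p.1 :=
    congrArg Prod.fst ((Nat.divModEquiv c).apply_symm_apply p)
  simpa only [Function.comp_def, hdiv, mul_one] using hprod

theorem summable_shieldBound : Summable (shieldBound k) :=
  (summable_pow_div (one_sub_half_pow_mem k).1 (one_sub_half_pow_mem k).2 (k + 1)).mul_left 2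

theorem summable_shieldBound_natAbs :
    Summable fun z : ℤ => shieldBound k ((z.natAbs - 1) / 2) := by
  have hnat : Summable fun d : ℕ => shieldBound k ((d - 1) / 2) := by
    rw [← summable_nat_add_iff 1]
    simpa only [shieldBound, Nat.add_sub_cancel, Nat.div_div_eq_div_mul] using
      (summable_pow_div (one_sub_half_pow_mem k).1 (one_sub_half_pow_mem k).2
        (2 * (k + 1))).mul_left 2
  exact Summable.of_nat_of_neg (by simpa using hnat) (by simpa using hnat)

end ShieldBound

section Shielding

variable {α : Type} {k L : ℕ} {φ : ℤ → α}

theorem ConstBlock.congr {ζ ξ : ℤ → ℤˣ} {a : ℤ} (hζ : ConstBlock k ζ a)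
    (h : Set.EqOn ζ ξ (Set.Icc a (a + k))) : ConstBlock k ξ a := fun x hx => by
  rw [← h (Finset.mem_Icc.mp hx), ← h ⟨le_rfl, by omega⟩, hζ x hx]

theorem dependsOn_constBlock [DecidableEq α] (k : ℕ) (φ : ℤ → α) (a : ℤ) :
    DependsOn (fun ω : α → ℤˣ => ConstBlock k (ω ∘ φ) a)
      ((Finset.Icc a (a + k)).image φ : Set α) := by
  intro ω ω' h
  have heq : Set.EqOn (ω ∘ φ) (ω' ∘ φ) (Set.Icc a (a + k)) := fun x hx =>
    h _ (Finset.mem_coe.mpr (Finset.mem_image_of_mem φ (Finset.mem_Icc.mpr hx)))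
  exact propext ⟨fun hω => hω.congr heq, fun hω' => hω'.congr heq.symm⟩

variable [Fintype α]

theorem fairSigns_real_not_constBlock_le (k : ℕ) (φ : ℤ → α) (a : ℤ) :
    (fairSigns α).real {ω | ¬ConstBlock k (ω ∘ φ) a} ≤ 1 - (1 / 2) ^ (k + 1) := by
  classical
  have hsub : {ω : α → ℤˣ | ∀ x ∈ (Finset.Icc a (a + k)).image φ, ω x = 1} ⊆
      {ω | ConstBlock k (ω ∘ φ) a} := fun ω hω x hx => by
    simp only [Function.comp_apply]
    rw [hω _ (Finset.mem_image_of_mem φ hx), hω _ (Finset.mem_image_of_mem φ (by simp))]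
  have hcard : ((Finset.Icc a (a + k)).image φ).card ≤ k + 1 :=
    Finset.card_image_le.trans (by rw [Int.card_Icc]; omega)
  rw [← Set.compl_ofPred, probReal_compl_eq_one_sub .of_discrete]
  refine sub_le_sub_left ?_ 1
  calc (1 / 2 : ℝ) ^ (k + 1) ≤ (1 / 2) ^ ((Finset.Icc a (a + k)).image φ).card :=
        pow_le_pow_of_le_one (by norm_num) (by norm_num) hcard
    _ = (fairSigns α).real {ω | ∀ x ∈ (Finset.Icc a (a + k)).image φ, ω x = 1} :=
        (fairSigns_real_forall_eq _ 1).symm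
    _ ≤ (fairSigns α).real {ω | ConstBlock k (ω ∘ φ) a} := measureReal_mono hsub

theorem fairSigns_real_no_constBlock_le (c : ℤ) (q : ℕ)
    (hφ : Set.InjOn φ (Set.Ico c (c + q * (k + 1)))) :
    (fairSigns α).real (⋂ j ∈ Finset.range q, {ω | ¬ConstBlock k (ω ∘ φ) (c + j * (k + 1))}) ≤
      (1 - (1 / 2) ^ (k + 1)) ^ q := by
  classical
  have hindex {j : ℕ} {x : ℤ} (hx : x ∈ Finset.Icc (c + j * (k + 1)) (c + j * (k + 1) + k)) :
      (x - c) / (k + 1) = j := by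
    rw [Finset.mem_Icc] at hx
    exact le_antisymm (Int.lt_add_one_iff.mp (Int.ediv_lt_of_lt_mul (by omega) (by linarith)))
      (Int.le_ediv_of_mul_le (by omega) (by linarith))
  have hmem {j : ℕ} (hj : j ∈ Finset.range q) {x : ℤ}
      (hx : x ∈ Finset.Icc (c + j * (k + 1)) (c + j * (k + 1) + k)) :
      x ∈ Set.Ico c (c + q * (k + 1)) := by
    have hjq : (j : ℤ) + 1 ≤ q := by exact_mod_cast Finset.mem_range.mp hj
    rw [Finset.mem_Icc] at hx
    constructor <;> nlinarith
  rw [fairSigns_real_biInter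
    (S := fun j : ℕ => (Finset.Icc (c + j * (k + 1) : ℤ) (c + j * (k + 1) + k)).image φ)]
  · calc _ ≤ ∏ _j ∈ Finset.range q, (1 - (1 / 2 : ℝ) ^ (k + 1)) :=
          Finset.prod_le_prod (fun _ _ => measureReal_nonneg) fun j _ =>
            fairSigns_real_not_constBlock_le k φ _
      _ = (1 - (1 / 2) ^ (k + 1)) ^ q := by rw [Finset.prod_const, Finset.card_range]
  · exact fun j _ ω ω' h => congrArg Not (dependsOn_constBlock k φ _ h)
  · intro i hi j hj hij
    simp only [Function.onFun, Finset.disjoint_left, Finset.mem_image]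
    rintro _ ⟨x, hx, rfl⟩ ⟨y, hy, hyx⟩
    obtain rfl := hφ (hmem hj hy) (hmem hi hx) hyx
    exact hij (by exact_mod_cast (hindex hx).symm.trans (hindex hy))

theorem fairSigns_real_not_shielded_le (hφ : Set.InjOn φ (Set.Icc (-L) L)) :
    (fairSigns α).real {ω | ¬Shielded k L (ω ∘ φ)} ≤ shieldBound k L := by
  set q := L / (k + 1) with hq
  have hqL : (q : ℤ) * (k + 1) ≤ L := by exact_mod_cast Nat.div_mul_le_self L (k + 1)
  have hsub : {ω : α → ℤˣ | ¬Shielded k L (ω ∘ φ)} ⊆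
      (⋂ j ∈ Finset.range q, {ω | ¬ConstBlock k (ω ∘ φ) (-L + j * (k + 1))}) ∪
        ⋂ j ∈ Finset.range q, {ω | ¬ConstBlock k (ω ∘ φ) (0 + j * (k + 1))} := by
    intro ω
    simp only [Set.mem_union, Set.mem_iInter, Set.mem_ofPred_eq, Finset.mem_range]
    contrapose!
    rintro ⟨⟨i, hi, hiB⟩, j, hj, hjB⟩
    have : (i : ℤ) + 1 ≤ q := by exact_mod_cast hi
    have : (j : ℤ) + 1 ≤ q := by exact_mod_cast hj
    exact ⟨⟨_, by nlinarith, by nlinarith, hiB⟩, _, by positivity, by nlinarith, hjB⟩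
  have hleft := fairSigns_real_no_constBlock_le (k := k) (-L) q
    (hφ.mono (Set.Ico_subset_Icc_self.trans (Set.Icc_subset_Icc_right (by omega))))
  have hright := fairSigns_real_no_constBlock_le (k := k) 0 q
    (hφ.mono (Set.Ico_subset_Icc_self.trans (Set.Icc_subset_Icc (by omega) (by omega))))
  calc (fairSigns α).real {ω | ¬Shielded k L (ω ∘ φ)}
      ≤ _ := (measureReal_mono hsub).trans (measureReal_union_le _ _)
    _ ≤ shieldBound k L := by rw [shieldBound, ← hq]; linarith

theorem fairSigns_real_lineStep_ne_le (hφ : Set.InjOn φ (Set.Icc (-L) L))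
    {ψ : (α → ℤˣ) → α → ℤˣ} (hψ : ∀ ω, Set.EqOn (ω ∘ φ) (ψ ω ∘ φ) (Set.Icc (-L) L)) (T : ℕ) :
    (fairSigns α).real {ω | (lineStep k)^[T] (ω ∘ φ) 0 ≠ (lineStep k)^[T] (ψ ω ∘ φ) 0} ≤
      shieldBound k L :=
  (measureReal_mono fun ω => mt fun hω => hω.iterate_congr (hψ ω) T).trans
    (fairSigns_real_not_shielded_le hφ)

theorem changeProb_lineStep_le [DecidableEq α] (hφ : Set.InjOn φ (Set.Icc (-L) L)) (T : ℕ)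
    (η : α → ℤˣ) :
    changeProb (fun ω => (lineStep k)^[T] (ω ∘ φ) 0) η ≤
      shieldBound k L + flipCount ((Finset.Icc (-(L : ℤ)) L).image φ) η := by
  refine changeProb_le_add_flipCount (shieldBound_nonneg k L) fun hη =>
    fairSigns_real_lineStep_ne_le hφ (fun ω x hx => ?_) T
  simp [hη _ (Finset.mem_image_of_mem φ (Finset.mem_Icc.mpr hx))]

end Shielding

/-! ### The tree-like graph -/

theorem changeProb_treeMajority_le (k n L : ℕ) :
    ∃ s : Finset (TreeLayer k n), s.card ≤ 2 * L + 1 ∧ ∀ η,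
      changeProb (treeMajority k n) η ≤ shieldBound k L + flipCount s η := by
  have : Nonempty (TreeLayer k n) :=
    ⟨0, Finset.mem_Icc.mpr ⟨neg_nonpos.mpr (by positivity), by positivity⟩⟩
  rcases le_total (k * n) L with hL | hL
  · refine ⟨Finset.univ, ?_, fun η =>
      changeProb_le_add_flipCount (shieldBound_nonneg k L) fun hη => ?_⟩
    · rw [Finset.card_univ, Fintype.card_coe, Int.card_Icc]
      lia
    · obtain rfl : η = 1 := funext fun x => hη x (Finset.mem_univ x)
      simpa [changeProb] using shieldBound_nonneg k L
  · set φ : ℤ → TreeLayer k n := Function.invFun Subtype.val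
    have hφ : Set.InjOn φ (Set.Icc (-L) L) := by
      have hval : Set.LeftInvOn Subtype.val φ (Set.Icc (-L) L) := fun x hx =>
        Function.invFun_eq ⟨⟨x, Finset.mem_Icc.mpr ⟨by nlinarith [hx.1], by nlinarith [hx.2]⟩⟩, rfl⟩
      exact hval.injOn
    have htree : treeMajority k n = fun ω => (lineStep k)^[n] (ω ∘ φ) 0 := funext fun ω => by
      rw [← treeMajority_restrict]
      congr 1
      funext i
      exact congrArg ω (Function.leftInverse_invFun Subtype.val_injective i).symm
    have hcard : ((Finset.Icc (-(L : ℤ)) L).image φ).card ≤ 2 * L + 1 :=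
      Finset.card_image_le.trans (by rw [Int.card_Icc]; omega)
    rw [htree]
    exact ⟨_, hcard, changeProb_lineStep_le hφ n⟩

theorem noiseStable_treeMajority (k : ℕ) : NoiseStable fun n : ℕ => treeMajority k n := by
  refine noiseStable_of_changeProb_le fun a ha => ?_
  obtain ⟨L, hL⟩ := ((summable_shieldBound k).tendsto_atTop_zero.eventually_lt_const ha).exists
  refine ⟨2 * L + 1, fun n => ?_⟩
  obtain ⟨s, hs, hchange⟩ := changeProb_treeMajority_le k n L
  refine ⟨s, 1, by rw [one_mul]; exact_mod_cast hs, fun η => (hchange η).trans ?_⟩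
  rw [one_mul]
  gcongr

/-! ### Covariances of local functions -/

section Covariance

open ProbabilityTheory

variable {Ω : Type*} [MeasurableSpace Ω] {μ : Measure Ω} [IsProbabilityMeasure μ]
  {X X' Y Y' : Ω → ℝ} {b e : ℝ}

theorem abs_covariance_le_of_abs_le (hX : MemLp X 2 μ) (hY : MemLp Y 2 μ) (hb : ∀ ω, |Y ω| ≤ b) :
    |cov[X, Y; μ]| ≤ 2 * b * ∫ ω, |X ω| ∂μ := by
  have hXint : Integrable X μ := hX.integrable one_le_two
  have hprod : |μ[X * Y]| ≤ b * ∫ ω, |X ω| ∂μ :=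
    calc |μ[X * Y]| ≤ ∫ ω, |X ω * Y ω| ∂μ := abs_integral_le_integral_abs
      _ ≤ ∫ ω, b * |X ω| ∂μ := integral_mono (hX.integrable_mul hY).abs (hXint.abs.const_mul b)
          fun ω => by
            simp only [abs_mul, mul_comm b]
            exact mul_le_mul_of_nonneg_left (hb ω) (abs_nonneg _)
      _ = b * ∫ ω, |X ω| ∂μ := integral_const_mul b _
  have hmean : |μ[X] * μ[Y]| ≤ b * ∫ ω, |X ω| ∂μ := by
    have hYb : |μ[Y]| ≤ b := abs_integral_le_integral_abs.trans <|
      (integral_mono (hY.integrable one_le_two).abs (integrable_const b) hb).trans (by simp)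
    rw [abs_mul, mul_comm]
    exact mul_le_mul hYb abs_integral_le_integral_abs (abs_nonneg _) ((abs_nonneg _).trans hYb)
  rw [covariance_eq_sub hX hY]
  linarith [abs_sub (μ[X * Y]) (μ[X] * μ[Y])]

theorem abs_covariance_le_of_indepFun (hX : MemLp X 2 μ) (hX' : MemLp X' 2 μ) (hY : MemLp Y 2 μ)
    (hY' : MemLp Y' 2 μ) (hbX' : ∀ ω, |X' ω| ≤ b) (hbY : ∀ ω, |Y ω| ≤ b)
    (hindep : IndepFun X' Y' μ) (heX : ∫ ω, |X ω - X' ω| ∂μ ≤ e)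
    (heY : ∫ ω, |Y ω - Y' ω| ∂μ ≤ e) : |cov[X, Y; μ]| ≤ 4 * b * e := by
  have hb : 0 ≤ b := by
    obtain ⟨ω⟩ := nonempty_of_isProbabilityMeasure μ
    exact (abs_nonneg _).trans (hbY ω)
  have hsplit : cov[X, Y; μ] = cov[X - X', Y; μ] + cov[Y - Y', X'; μ] := by
    rw [covariance_sub_left hX hX' hY, covariance_sub_left hY hY' hX', covariance_comm Y,
      covariance_comm Y', hindep.covariance_eq_zero hX' hY']
    ring
  have h1 := abs_covariance_le_of_abs_le (hX.sub hX') hY hbY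
  have h2 := abs_covariance_le_of_abs_le (hY.sub hY') hX' hbX'
  simp only [Pi.sub_apply] at h1 h2
  rw [hsplit]
  refine (abs_add_le _ _).trans ?_
  nlinarith

end Covariance

section NoiseChange

open ProbabilityTheory

variable {α : Type} {F F' G G' : (α → ℤˣ) → ℤˣ} {S S' : Finset α} {β : ℝ}

/-- The amount by which multiplying `ω` by the noise vector `η` decreases `F`. -/
def noiseChange (F : (α → ℤˣ) → ℤˣ) (η ω : α → ℤˣ) : ℝ :=
  ((F ω : ℤ) : ℝ) - ((F (ω * η) : ℤ) : ℝ)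

theorem abs_unit_sub_unit (u v : ℤˣ) :
    |((u : ℤ) : ℝ) - ((v : ℤ) : ℝ)| = if u ≠ v then 2 else 0 := by
  rcases Int.units_eq_one_or u with rfl | rfl <;> rcases Int.units_eq_one_or v with rfl | rfl <;>
    norm_num [show (1 : ℤˣ) ≠ -1 by decide, show (-1 : ℤˣ) ≠ 1 by decide]

theorem abs_noiseChange_le (F : (α → ℤˣ) → ℤˣ) (η ω : α → ℤˣ) : |noiseChange F η ω| ≤ 2 := by
  rw [noiseChange, abs_unit_sub_unit]
  split_ifs <;> norm_num

theorem dependsOn_noiseChange (hF : DependsOn F S) (η : α → ℤˣ) :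
    DependsOn (noiseChange F η) S := fun ω ω' h => by
  have hη : F (ω * η) = F (ω' * η) := hF fun x hx => congrArg (· * η x) (h x hx)
  rw [noiseChange, noiseChange, hF h, hη]

variable [Fintype α]

theorem integral_abs_unit_sub_unit (F G : (α → ℤˣ) → ℤˣ) :
    ∫ ω, |((F ω : ℤ) : ℝ) - ((G ω : ℤ) : ℝ)| ∂fairSigns α =
      2 * (fairSigns α).real {ω | F ω ≠ G ω} := by
  have hind (ω : α → ℤˣ) : |((F ω : ℤ) : ℝ) - ((G ω : ℤ) : ℝ)| =
      2 * {ω | F ω ≠ G ω}.indicator 1 ω := by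
    simp [abs_unit_sub_unit, Set.indicator_apply]
  simp only [hind]
  rw [integral_const_mul, integral_indicator_one .of_discrete]

theorem integral_comp_mul_right (η : α → ℤˣ) (X : (α → ℤˣ) → ℝ) :
    ∫ ω, X (ω * η) ∂fairSigns α = ∫ ω, X ω ∂fairSigns α :=
  (measurePreserving_mul_right_fairSigns η).integral_comp
    (MeasurableEquiv.mulRight η).measurableEmbedding X

theorem integral_noiseChange (F : (α → ℤˣ) → ℤˣ) (η : α → ℤˣ) :
    ∫ ω, noiseChange F η ω ∂fairSigns α = 0 := by
  unfold noiseChange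
  rw [integral_sub .of_finite .of_finite,
    integral_comp_mul_right η fun ω => ((F ω : ℤ) : ℝ), sub_self]

theorem integral_abs_noiseChange_sub_le (F F' : (α → ℤˣ) → ℤˣ) (η : α → ℤˣ) :
    ∫ ω, |noiseChange F η ω - noiseChange F' η ω| ∂fairSigns α ≤
      4 * (fairSigns α).real {ω | F ω ≠ F' ω} := by
  set D : (α → ℤˣ) → ℝ := fun ω => |((F ω : ℤ) : ℝ) - ((F' ω : ℤ) : ℝ)|
  calc ∫ ω, |noiseChange F η ω - noiseChange F' η ω| ∂fairSigns α
      ≤ ∫ ω, (D ω + D (ω * η)) ∂fairSigns α :=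
        integral_mono .of_finite .of_finite fun ω => by
          unfold noiseChange
          rw [sub_sub_sub_comm]
          exact abs_sub _ _
    _ = 4 * (fairSigns α).real {ω | F ω ≠ F' ω} := by
        rw [integral_add .of_finite .of_finite, integral_comp_mul_right η D,
          integral_abs_unit_sub_unit]
        ring

theorem abs_covariance_noiseChange_le_changeProb (F G : (α → ℤˣ) → ℤˣ) (η : α → ℤˣ) :
    |cov[noiseChange F η, noiseChange G η; fairSigns α]| ≤ 8 * changeProb F η := by
  refine (abs_covariance_le_of_abs_le .of_discrete .of_discrete
    (abs_noiseChange_le G η)).trans_eq ?_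
  unfold noiseChange
  rw [integral_abs_unit_sub_unit, changeProb]
  ring

theorem abs_covariance_noiseChange_le_of_dependsOn (hF' : DependsOn F' S) (hG' : DependsOn G' S')
    (hSS' : Disjoint S S') (hF : (fairSigns α).real {ω | F ω ≠ F' ω} ≤ β)
    (hG : (fairSigns α).real {ω | G ω ≠ G' ω} ≤ β) (η : α → ℤˣ) :
    |cov[noiseChange F η, noiseChange G η; fairSigns α]| ≤ 32 * β := by
  have h := abs_covariance_le_of_indepFun (e := 4 * β) .of_discrete .of_discrete .of_discrete
    .of_discrete (abs_noiseChange_le F' η) (abs_noiseChange_le G η)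
    (indepFun_pi_of_dependsOn (dependsOn_noiseChange hF' η) (dependsOn_noiseChange hG' η) hSS')
    ((integral_abs_noiseChange_sub_le F F' η).trans (by linarith))
    ((integral_abs_noiseChange_sub_le G G' η).trans (by linarith))
  exact h.trans_eq (by ring)

end NoiseChange

/-! ### The noise barely moves the final sum -/

section SiteChange

open ProbabilityTheory

variable {k n : ℕ}

/-- The amount by which the noise vector `η` decreases the value of site `i` after `T` steps. -/
noncomputable def siteChange (k T : ℕ) {n : ℕ} (η : ZMod n → ℤˣ) (i : ZMod n) :
    (ZMod n → ℤˣ) → ℝ :=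
  noiseChange (fun ω => (cycleStep k n)^[T] ω i) η

theorem mem_cycleChildren {i j : ZMod n} :
    j ∈ cycleChildren k n i ↔ ∃ d : ℤ, |d| ≤ k ∧ i + d = j := by
  simp only [cycleChildren, Finset.mem_image, Finset.mem_Icc, abs_le]

theorem mem_cycleChildren_comm {i j : ZMod n} :
    j ∈ cycleChildren k n i ↔ i ∈ cycleChildren k n j := by
  simp only [mem_cycleChildren]
  constructor <;>
  · rintro ⟨d, hd, rfl⟩
    exact ⟨-d, by rwa [abs_neg], by push_cast; ring⟩

theorem card_cycleChildren_le (k : ℕ) (i : ZMod n) : (cycleChildren k n i).card ≤ 2 * k + 1 :=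
  Finset.card_image_le.trans (by rw [Int.card_Icc]; omega)

variable [NeZero n]

theorem disjoint_cycleChildren {i j : ZMod n} (h : 2 * k < (i - j).valMinAbs.natAbs) :
    Disjoint (cycleChildren k n i) (cycleChildren k n j) := by
  rw [Finset.disjoint_left]
  intro x hi hj
  obtain ⟨d, hd, rfl⟩ := mem_cycleChildren.mp hi
  obtain ⟨d', hd', hx⟩ := mem_cycleChildren.mp hj
  have hij : i - j = ((d' - d : ℤ) : ZMod n) := by push_cast; linear_combination -hx
  have := ZMod.natAbs_valMinAbs_le (i - j)
  have hval : (i - j).valMinAbs = d' - d :=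
    (ZMod.valMinAbs_spec _ _).mpr ⟨hij, by constructor <;> grind⟩
  grind

theorem sum_flipCount_cycleChildren_le (k : ℕ) (η : ZMod n → ℤˣ) :
    ∑ i, flipCount (cycleChildren k n i) η ≤ flipCount Finset.univ η * (2 * k + 1) := by
  calc ∑ i, flipCount (cycleChildren k n i) η
      = ∑ j with η j = -1, (cycleChildren k n j).card := by
        simp only [flipCount, Finset.card_eq_sum_ones]
        refine Finset.sum_comm' fun i j => ?_
        simp only [Finset.mem_filter, Finset.mem_univ, true_and]
        rw [and_comm, mem_cycleChildren_comm, and_comm]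
    _ ≤ flipCount Finset.univ η * (2 * k + 1) :=
        Finset.sum_le_card_nsmul _ _ _ fun j _ => card_cycleChildren_le k j

theorem changeProb_iterate_cycleStep_le {L : ℕ} (hk : 2 * k < n) (hL : 2 * L < n) (T : ℕ)
    (i : ZMod n) (η : ZMod n → ℤˣ) :
    changeProb (fun ω => (cycleStep k n)^[T] ω i) η ≤
      shieldBound k L + flipCount (cycleChildren L n i) η := by
  simp only [iterate_cycleStep_eq_lineStep hk]
  exact changeProb_lineStep_le (injOn_add_intCast (by omega) i) T η

theorem exists_dependsOn_cycleChildren {L : ℕ} (hk : 2 * k < n) (hL : 2 * L < n) (T : ℕ)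
    (i : ZMod n) : ∃ F : (ZMod n → ℤˣ) → ℤˣ, DependsOn F (cycleChildren L n i : Set (ZMod n)) ∧
      (fairSigns (ZMod n)).real {ω | (cycleStep k n)^[T] ω i ≠ F ω} ≤ shieldBound k L := by
  refine ⟨fun ω => (cycleStep k n)^[T] ((cycleChildren L n i).piecewise ω 1) i,
    fun ω ω' h => ?_, ?_⟩
  · simp only [(cycleChildren L n i).piecewise_congr h fun _ _ => rfl]
  · simp only [iterate_cycleStep_eq_lineStep hk]
    refine fairSigns_real_lineStep_ne_le (injOn_add_intCast (by omega) i) (fun ω x hx => ?_) T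
    exact (Finset.piecewise_eq_of_mem _ _ _
      (mem_cycleChildren.mpr ⟨x, abs_le.mpr hx, rfl⟩)).symm

theorem abs_covariance_siteChange_le (hk : 2 * k < n) (T : ℕ) (η : ZMod n → ℤˣ) {i j : ZMod n}
    (hij : i ≠ j) : |cov[siteChange k T η i, siteChange k T η j; fairSigns (ZMod n)]| ≤
      32 * shieldBound k (((i - j).valMinAbs.natAbs - 1) / 2) := by
  have hpos : (i - j).valMinAbs ≠ 0 := mt (ZMod.valMinAbs_eq_zero _).mp (sub_ne_zero.mpr hij)
  have hle := ZMod.natAbs_valMinAbs_le (i - j)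
  set L := ((i - j).valMinAbs.natAbs - 1) / 2
  obtain ⟨F, hF, hFi⟩ := exists_dependsOn_cycleChildren (L := L) hk (by omega) T i
  obtain ⟨G, hG, hGj⟩ := exists_dependsOn_cycleChildren (L := L) hk (by omega) T j
  exact abs_covariance_noiseChange_le_of_dependsOn hF hG (disjoint_cycleChildren (by omega))
    hFi hGj η

theorem sum_abs_covariance_siteChange_le (hk : 2 * k < n) {s : Finset ℤ} (h0 : 0 ∈ s) {e : ℝ}
    (hs : ∀ t : Finset ℤ, Disjoint t s → ∑ z ∈ t, shieldBound k ((z.natAbs - 1) / 2) ≤ e) (T : ℕ)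
    (η : ZMod n → ℤˣ) (i : ZMod n) :
    ∑ j, |cov[siteChange k T η i, siteChange k T η j; fairSigns (ZMod n)]| ≤
      8 * s.card * changeProb (fun ω => (cycleStep k n)^[T] ω i) η + 32 * e := by
  have hinj : Function.Injective fun j : ZMod n => (i - j).valMinAbs :=
    ZMod.injective_valMinAbs.comp sub_right_injective
  rw [← Finset.sum_filter_add_sum_filter_not _ fun j => (i - j).valMinAbs ∈ s]
  refine add_le_add ?_ ?_
  · have hcard : (Finset.univ.filter fun j => (i - j).valMinAbs ∈ s).card ≤ s.card :=
      Finset.card_le_card_of_injOn _ (fun j hj => (Finset.mem_filter.mp hj).2) hinj.injOn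
    calc _ ≤ (Finset.univ.filter fun j => (i - j).valMinAbs ∈ s).card *
          (8 * changeProb (fun ω => (cycleStep k n)^[T] ω i) η) := by
          rw [← nsmul_eq_mul]
          exact Finset.sum_le_card_nsmul _ _ _ fun j _ =>
            abs_covariance_noiseChange_le_changeProb _ _ η
      _ ≤ s.card * (8 * changeProb (fun ω => (cycleStep k n)^[T] ω i) η) := by
          have := changeProb_nonneg (fun ω => (cycleStep k n)^[T] ω i) η
          gcongr
      _ = _ := by ring
  · calc _ ≤ ∑ j with (i - j).valMinAbs ∉ s,
          32 * shieldBound k (((i - j).valMinAbs.natAbs - 1) / 2) :=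
          Finset.sum_le_sum fun j hj => abs_covariance_siteChange_le hk T η <| by
            rintro rfl
            simp [h0] at hj
      _ = 32 * ∑ z ∈ (Finset.univ.filter fun j => (i - j).valMinAbs ∉ s).image
            fun j => (i - j).valMinAbs, shieldBound k ((z.natAbs - 1) / 2) := by
          rw [← Finset.mul_sum, Finset.sum_image hinj.injOn]
      _ ≤ 32 * e := by
          refine mul_le_mul_of_nonneg_left
            (hs _ (Finset.disjoint_left.mpr fun z hz => ?_)) (by norm_num)
          obtain ⟨j, hj, rfl⟩ := Finset.mem_image.mp hz
          exact (Finset.mem_filter.mp hj).2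

end SiteChange

open ProbabilityTheory in
theorem exists_variance_sum_siteChange_le (k : ℕ) {a : ℝ} (ha : 0 < a) :
    ∃ (C : ℝ) (M : ℕ), ∀ (n : ℕ) [NeZero n], M ≤ n → ∀ (T : ℕ) (η : ZMod n → ℤˣ),
      Var[fun ω => ∑ i, siteChange k T η i ω; fairSigns (ZMod n)] ≤
        a * n + C * flipCount Finset.univ η := by
  obtain ⟨s, hs⟩ := summable_iff_vanishing_norm.mp (summable_shieldBound_natAbs k) (a / 64)
    (by positivity)
  obtain ⟨c, hc⟩ : ∃ c : ℝ, c = 8 * (insert 0 s).card := ⟨_, rfl⟩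
  have hc0 : 0 < c := by rw [hc]; positivity
  obtain ⟨L, hL⟩ := ((summable_shieldBound k).tendsto_atTop_zero.eventually_lt_const
    (show 0 < a / (2 * c) by positivity)).exists
  refine ⟨c * (2 * L + 1), 2 * (k + L) + 1, fun n _ hn T η => ?_⟩
  have hrow (i : ZMod n) :
      ∑ j, cov[siteChange k T η i, siteChange k T η j; fairSigns (ZMod n)] ≤
        a + c * flipCount (cycleChildren L n i) η := by
    have htail : ∀ t : Finset ℤ, Disjoint t (insert 0 s) →
        ∑ z ∈ t, shieldBound k ((z.natAbs - 1) / 2) ≤ a / 64 := fun t ht =>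
      (Real.le_norm_self _).trans (hs t (ht.mono_right (Finset.subset_insert 0 s))).le
    have h1 := sum_abs_covariance_siteChange_le (n := n) (by omega) (Finset.mem_insert_self 0 s)
      htail T η i
    have h2 := changeProb_iterate_cycleStep_le (by omega : 2 * k < n) (by omega : 2 * L < n) T i η
    rw [← hc] at h1
    calc _ ≤ _ := (Finset.sum_le_sum fun j _ => le_abs_self _).trans h1
      _ ≤ c * (a / (2 * c) + flipCount (cycleChildren L n i) η) + 32 * (a / 64) := by
          gcongr
          exact h2.trans (by gcongr)
      _ = a + c * flipCount (cycleChildren L n i) η := by field_simp; ring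
  rw [variance_fun_sum fun _ => .of_discrete]
  calc _ ≤ ∑ i : ZMod n, (a + c * flipCount (cycleChildren L n i) η) :=
        Finset.sum_le_sum fun i _ => hrow i
    _ = a * n + c * ((∑ i, flipCount (cycleChildren L n i) η : ℕ) : ℝ) := by
        rw [Finset.sum_add_distrib, ← Finset.mul_sum, Finset.sum_const, Finset.card_univ,
          ZMod.card, nsmul_eq_mul, mul_comm (n : ℝ)]
        push_cast
        rfl
    _ ≤ a * n + c * ((flipCount Finset.univ η * (2 * L + 1) : ℕ) : ℝ) := by
        gcongr
        exact sum_flipCount_cycleChildren_le L η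
    _ = a * n + c * (2 * L + 1) * flipCount Finset.univ η := by push_cast; ring

/-! ### Sums of random signs -/

theorem centralBinom_sq_mul_le (m : ℕ) : m.centralBinom ^ 2 * (2 * m + 1) ≤ 4 ^ (2 * m) := by
  induction m with
  | zero => simp
  | succ m ih =>
    have hrec := Nat.succ_mul_centralBinom_succ m
    refine Nat.le_of_mul_le_mul_left (c := (m + 1) ^ 2) ?_ (by positivity)
    calc (m + 1) ^ 2 * ((m + 1).centralBinom ^ 2 * (2 * (m + 1) + 1))
        = ((m + 1) * (m + 1).centralBinom) ^ 2 * (2 * m + 3) := by ring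
      _ = (m.centralBinom ^ 2 * (2 * m + 1)) * (4 * ((2 * m + 1) * (2 * m + 3))) := by
          rw [hrec]; ring
      _ ≤ 4 ^ (2 * m) * (4 * (4 * (m + 1) ^ 2)) :=
          Nat.mul_le_mul ih (Nat.mul_le_mul_left _ (by nlinarith))
      _ = (m + 1) ^ 2 * 4 ^ (2 * (m + 1)) := by ring

theorem choose_sq_mul_le (N t : ℕ) : N.choose t ^ 2 * N ≤ 4 ^ N := by
  obtain ⟨m, rfl | rfl⟩ := Nat.even_or_odd' N
  · calc (2 * m).choose t ^ 2 * (2 * m) ≤ m.centralBinom ^ 2 * (2 * m + 1) := by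
          gcongr
          exacts [Nat.choose_le_centralBinom t m, Nat.le_succ _]
      _ ≤ 4 ^ (2 * m) := centralBinom_sq_mul_le m
  · have hchoose : (2 * m + 1).choose t ≤ 2 * m.centralBinom := by
      cases t with
      | zero => have := m.centralBinom_pos; rw [Nat.choose_zero_right]; omega
      | succ t =>
        rw [Nat.choose_succ_succ', two_mul m.centralBinom]
        exact add_le_add (Nat.choose_le_centralBinom t m) (Nat.choose_le_centralBinom (t + 1) m)
    calc (2 * m + 1).choose t ^ 2 * (2 * m + 1) ≤ (2 * m.centralBinom) ^ 2 * (2 * m + 1) := by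
          gcongr
      _ = 4 * (m.centralBinom ^ 2 * (2 * m + 1)) := by ring
      _ ≤ 4 * 4 ^ (2 * m) := by gcongr; exact centralBinom_sq_mul_le m
      _ = 4 ^ (2 * m + 1) := by ring

theorem choose_le_two_pow_div_sqrt {N : ℕ} (hN : 0 < N) (t : ℕ) :
    (N.choose t : ℝ) ≤ 2 ^ N / √N := by
  have hsq : (N.choose t : ℝ) ^ 2 * N ≤ 4 ^ N := by exact_mod_cast choose_sq_mul_le N t
  rw [le_div_iff₀ (Real.sqrt_pos.2 (by exact_mod_cast hN))]
  refine (pow_le_pow_iff_left₀ (by positivity) (by positivity) two_ne_zero).1 ?_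
  rwa [mul_pow, Real.sq_sqrt (Nat.cast_nonneg N), ← pow_mul, mul_comm N 2, pow_mul,
    show (2 : ℝ) ^ 2 = 4 by norm_num]

section SmallBall

variable {α : Type} {G : Finset α}

theorem signSum_eq_card_sub_flipCount (G : Finset α) (θ : α → ℤˣ) :
    ∑ j ∈ G, (θ j : ℤ) = G.card - 2 * flipCount G θ := by
  have hsign (j : α) : (θ j : ℤ) = 1 - 2 * if θ j = -1 then 1 else 0 := by
    rcases Int.units_eq_one_or (θ j) with h | h <;> rw [h] <;> decide
  rw [Finset.sum_congr rfl fun j _ => hsign j, Finset.sum_sub_distrib, ← Finset.mul_sum,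
    Finset.sum_boole, Finset.sum_const, nsmul_one]
  rfl

variable [Fintype α]

theorem fairSigns_real_flipCount_eq_le (G : Finset α) (s : ℕ) :
    (fairSigns α).real {θ | flipCount G θ = s} ≤ G.card.choose s * (1 / 2) ^ G.card := by
  classical
  have hcover : {θ : α → ℤˣ | flipCount G θ = s} ⊆
      ⋃ A ∈ G.powersetCard s, {θ | ∀ x ∈ G, θ x = if x ∈ A then -1 else 1} := by
    intro θ hθ
    refine Set.mem_biUnion (x := G.filter (θ · = -1))
      (Finset.mem_powersetCard.mpr ⟨Finset.filter_subset _ _, hθ⟩) fun x hx => ?_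
    split_ifs with hmem
    · exact (Finset.mem_filter.mp hmem).2
    · exact (Int.units_eq_one_or _).resolve_right fun h => hmem (Finset.mem_filter.mpr ⟨hx, h⟩)
  calc (fairSigns α).real {θ | flipCount G θ = s}
      ≤ ∑ A ∈ G.powersetCard s,
          (fairSigns α).real {θ | ∀ x ∈ G, θ x = if x ∈ A then -1 else 1} :=
        (measureReal_mono hcover (measure_ne_top _ _)).trans (measureReal_biUnion_finset_le _ _)
    _ = G.card.choose s * (1 / 2) ^ G.card := by
        rw [Finset.sum_congr rfl fun A _ => fairSigns_real_forall_eq G _, Finset.sum_const,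
          Finset.card_powersetCard, nsmul_eq_mul]

theorem fairSigns_real_signSum_eq_le (hG : G.Nonempty) (u : α → ℤˣ) (t : ℤ) :
    (fairSigns α).real {θ | ∑ j ∈ G, ((θ j * u j : ℤˣ) : ℤ) = t} ≤ 1 / √G.card := by
  have hpre : (fairSigns α).real {θ | ∑ j ∈ G, ((θ j * u j : ℤˣ) : ℤ) = t} =
      (fairSigns α).real {θ | ∑ j ∈ G, (θ j : ℤ) = t} :=
    (measurePreserving_mul_right_fairSigns u).measureReal_preimage
      (s := {θ : α → ℤˣ | ∑ j ∈ G, (θ j : ℤ) = t}) MeasurableSet.of_discrete.nullMeasurableSet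
  have hflip : {θ : α → ℤˣ | ∑ j ∈ G, (θ j : ℤ) = t} ⊆
      {θ | flipCount G θ = ((G.card - t) / 2).toNat} := by
    intro θ hθ
    have := signSum_eq_card_sub_flipCount G θ
    simp only [Set.mem_ofPred_eq] at hθ ⊢
    omega
  calc (fairSigns α).real {θ | ∑ j ∈ G, ((θ j * u j : ℤˣ) : ℤ) = t}
      ≤ G.card.choose ((G.card - t) / 2).toNat * (1 / 2) ^ G.card :=
        hpre.trans_le ((measureReal_mono hflip).trans (fairSigns_real_flipCount_eq_le G _))
    _ ≤ 2 ^ G.card / √G.card * (1 / 2) ^ G.card :=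
        mul_le_mul_of_nonneg_right (choose_le_two_pow_div_sqrt hG.card_pos _) (by positivity)
    _ = 1 / √G.card := by
        rw [div_mul_eq_mul_div, ← mul_pow, mul_one_div_cancel two_ne_zero, one_pow]

theorem fairSigns_real_abs_add_signSum_le (hG : G.Nonempty) (u : α → ℤˣ) (c : ℤ) {q : ℤ}
    (hq : q ≠ 0) (r : ℕ) :
    (fairSigns α).real {θ | |c + q * ∑ j ∈ G, ((θ j * u j : ℤˣ) : ℤ)| ≤ r} ≤
      (2 * r + 1) / √G.card := by
  have hcover : {θ : α → ℤˣ | |c + q * ∑ j ∈ G, ((θ j * u j : ℤˣ) : ℤ)| ≤ r} ⊆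
      ⋃ t ∈ Finset.Icc (-(r : ℤ)) r, {θ | ∑ j ∈ G, ((θ j * u j : ℤˣ) : ℤ) = (t - c) / q} := by
    intro θ hθ
    refine Set.mem_biUnion (Finset.mem_Icc.mpr (abs_le.mp hθ)) ?_
    rw [Set.mem_ofPred_eq, add_sub_cancel_left, Int.mul_ediv_cancel_left _ hq]
  have hcard : ((Finset.Icc (-(r : ℤ)) r).card : ℝ) = 2 * r + 1 := by
    rw [Int.card_Icc, show ((r : ℤ) + 1 - -r).toNat = 2 * r + 1 by omega]
    push_cast; rfl
  calc (fairSigns α).real {θ | |c + q * ∑ j ∈ G, ((θ j * u j : ℤˣ) : ℤ)| ≤ r}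
      ≤ ∑ t ∈ Finset.Icc (-(r : ℤ)) r,
          (fairSigns α).real {θ | ∑ j ∈ G, ((θ j * u j : ℤˣ) : ℤ) = (t - c) / q} :=
        (measureReal_mono hcover (measure_ne_top _ _)).trans (measureReal_biUnion_finset_le _ _)
    _ ≤ ∑ t ∈ Finset.Icc (-(r : ℤ)) r, 1 / √G.card :=
        Finset.sum_le_sum fun t _ => fairSigns_real_signSum_eq_le hG u _
    _ = (2 * r + 1) / √G.card := by
        rw [Finset.sum_const, nsmul_eq_mul, hcard, mul_one_div]

end SmallBall

section RandomSubset

open ProbabilityTheory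

variable {α ι : Type} [Fintype α] [Fintype ι]

theorem fairSigns_real_card_le [Nonempty ι] {J : (α → ℤˣ) → Finset ι} {S : ι → Finset α} {p : ℝ}
    (hJ : ∀ j, DependsOn (j ∈ J ·) (S j : Set α)) (hS : Pairwise (Function.onFun Disjoint S))
    (hp : 0 < p) (hJp : ∀ j, p ≤ (fairSigns α).real {ω | j ∈ J ω}) :
    (fairSigns α).real {ω | ((J ω).card : ℝ) ≤ p * Fintype.card ι / 2} ≤
      1 / (p ^ 2 * Fintype.card ι) := by
  classical
  set m : ℝ := (Fintype.card ι : ℝ)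
  have hm : 0 < m := Nat.cast_pos.mpr Fintype.card_pos
  set Y : ι → (α → ℤˣ) → ℝ := fun j => {ω | j ∈ J ω}.indicator 1
  have hcount (ω : α → ℤˣ) : ((J ω).card : ℝ) = (∑ j, Y j) ω := by
    simp [Y, Finset.sum_apply, Set.indicator_apply]
  have hmean : p * m ≤ ∫ ω, (∑ j, Y j) ω ∂fairSigns α := by
    simp only [Finset.sum_apply]
    rw [integral_finsetSum _ fun _ _ => .of_finite]
    calc p * m = ∑ _j : ι, p := by rw [Finset.sum_const, nsmul_eq_mul, mul_comm]; rfl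
      _ ≤ _ := Finset.sum_le_sum fun j _ =>
        (hJp j).trans_eq (integral_indicator_one MeasurableSet.of_discrete).symm
  have hvar : Var[∑ j, Y j; fairSigns α] ≤ m / 4 := by
    have hY (j : ι) : DependsOn (Y j) (S j : Set α) := fun ω ω' h => by
      simp only [Y, Set.indicator_apply, Set.mem_ofPred_eq, hJ j h, Pi.one_apply]
    have hindep : Set.Pairwise (Finset.univ : Finset ι) fun i j => Y i ⟂ᵢ[fairSigns α] Y j :=
      fun i _ j _ hij => indepFun_pi_of_dependsOn (hY i) (hY j) (hS hij)
    rw [IndepFun.variance_sum (fun _ _ => .of_discrete) hindep]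
    calc ∑ j, Var[Y j; fairSigns α] ≤ ∑ _j : ι, ((1 - 0) / 2 : ℝ) ^ 2 :=
          Finset.sum_le_sum fun j _ => variance_le_sq_of_bounded
            (ae_of_all _ fun ω => ⟨Set.indicator_nonneg (fun _ _ => zero_le_one) ω,
              Set.indicator_le_self' (fun _ _ => zero_le_one) ω⟩)
            (measurable_of_finite _).aemeasurable
      _ = m / 4 := by rw [Finset.sum_const, nsmul_eq_mul, Finset.card_univ]; ring
  have hcheb := meas_ge_le_variance_div_sq (μ := fairSigns α) (X := ∑ j, Y j) .of_discrete
    (show 0 < p * m / 2 by positivity)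
  calc (fairSigns α).real {ω | ((J ω).card : ℝ) ≤ p * m / 2}
      ≤ (fairSigns α).real {ω | p * m / 2 ≤ |(∑ j, Y j) ω - ∫ ω, (∑ j, Y j) ω ∂fairSigns α|} := by
        refine measureReal_mono fun ω hω => ?_
        rw [Set.mem_ofPred_eq, hcount] at hω
        rw [Set.mem_ofPred_eq, abs_sub_comm]
        exact le_trans (by linarith) (le_abs_self _)
    _ ≤ Var[∑ j, Y j; fairSigns α] / (p * m / 2) ^ 2 :=
        ENNReal.toReal_le_of_le_ofReal (div_nonneg (variance_nonneg _ _) (by positivity)) hcheb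
    _ ≤ m / 4 / (p * m / 2) ^ 2 := by gcongr
    _ = 1 / (p ^ 2 * m) := by field_simp; norm_num

end RandomSubset

theorem measureReal_le_add_of_measurePreserving {Ω Θ : Type*} [MeasurableSpace Ω]
    [MeasurableSpace Θ] [Countable Ω] [Countable Θ] [DiscreteMeasurableSpace Ω]
    [DiscreteMeasurableSpace Θ] {μ : Measure Ω} {ν : Measure Θ}
    [IsProbabilityMeasure μ] [IsProbabilityMeasure ν] {e : Θ → Ω → Ω}
    (he : ∀ θ, MeasurePreserving (e θ) μ μ) {E F : Set Ω} {c : ℝ} (hc : 0 ≤ c)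
    (hE : ∀ ω ∉ F, ν.real {θ | e θ ω ∈ E} ≤ c) : μ.real E ≤ μ.real F + c := by
  have hE' (ω : Ω) : ν {θ | e θ ω ∈ E} ≤ F.indicator 1 ω + ENNReal.ofReal c := by
    by_cases hω : ω ∈ F
    · rw [Set.indicator_of_mem hω]
      exact prob_le_one.trans le_self_add
    · rw [Set.indicator_of_notMem hω, zero_add, ← ofReal_measureReal]
      exact ENNReal.ofReal_le_ofReal (hE ω hω)
  have hswap : μ E = ∫⁻ ω, ν {θ | e θ ω ∈ E} ∂μ := by
    have hprod := (Measure.prod_apply (μ := μ) (ν := ν)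
      (MeasurableSet.of_discrete (s := {x : Ω × Θ | e x.2 x.1 ∈ E}))).symm.trans
      (Measure.prod_apply_symm .of_discrete)
    calc μ E = ∫⁻ _, μ E ∂ν := by rw [lintegral_const, measure_univ, mul_one]
      _ = ∫⁻ θ, μ (e θ ⁻¹' E) ∂ν := lintegral_congr fun θ =>
        ((he θ).measure_preimage MeasurableSet.of_discrete.nullMeasurableSet).symm
      _ = _ := hprod.symm
  have hle : μ E ≤ μ F + ENNReal.ofReal c := by
    calc μ E ≤ ∫⁻ ω, (F.indicator 1 ω + ENNReal.ofReal c) ∂μ := hswap.trans_le (lintegral_mono hE')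
      _ = μ F + ENNReal.ofReal c := by
        rw [lintegral_add_right _ measurable_const, lintegral_indicator_one .of_discrete,
          lintegral_const, measure_univ, mul_one]
  calc μ.real E ≤ (μ F + ENNReal.ofReal c).toReal :=
        ENNReal.toReal_mono (by finiteness) hle
    _ = μ.real F + c := by
        rw [ENNReal.toReal_add (measure_ne_top _ _) ENNReal.ofReal_ne_top, ENNReal.toReal_ofReal hc]
        rfl

/-! ### Switching cells -/

section Cells

variable {V ι : Type} {N : V → Finset V}
  {block : ι → Fin 3 → Finset V} {q : ℕ}

/-- Cells for the automaton with neighbourhoods `N`: each consists of three disjoint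
self-supporting blocks of `q` sites, and only sites of the same cell see its middle block
`block j 1`. While the blocks of a cell are constant, the sign of its middle block therefore
influences nothing else. -/
structure IsCellSystem [DecidableEq V] (N : V → Finset V) (block : ι → Fin 3 → Finset V) (q : ℕ) :
    Prop where
  selfSupporting : ∀ j b, SelfSupporting N (block j b)
  card_block : ∀ j b, (block j b).card = q
  disjoint : Pairwise (Function.onFun Disjoint fun c : ι × Fin 3 => block c.1 c.2)
  exists_mem_of_mem : ∀ {j v w}, w ∈ block j 1 → w ∈ N v → ∃ b, v ∈ block j b

theorem IsCellSystem.eq_of_mem [DecidableEq V] (h : IsCellSystem N block q) {i j : ι}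
    {a b : Fin 3} {v : V} (hi : v ∈ block i a) (hj : v ∈ block j b) : i = j ∧ a = b := by
  by_contra hne
  have hdisj := h.disjoint (i := (i, a)) (j := (j, b)) (by rwa [Ne, Prod.mk.injEq])
  exact Finset.disjoint_left.mp hdisj hi hj

variable [Fintype ι]

/-- The good cells of `ω`: those on each of whose three blocks `ω` is constant. -/
def goodCells (block : ι → Fin 3 → Finset V) (ω : V → ℤˣ) : Finset ι :=
  {j | ∀ b, ∃ u, ∀ v ∈ block j b, ω v = u}

theorem mem_goodCells {ω : V → ℤˣ} {j : ι} :
    j ∈ goodCells block ω ↔ ∀ b, ∃ u, ∀ v ∈ block j b, ω v = u :=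
  Finset.mem_filter_univ j

theorem goodCells_mul {σ : V → ℤˣ} (hσ : ∀ j b, ∃ s, ∀ v ∈ block j b, σ v = s) (ω : V → ℤˣ) :
    goodCells block (σ * ω) = goodCells block ω := by
  ext j
  simp only [mem_goodCells]
  refine forall_congr' fun b => ?_
  obtain ⟨s, hs⟩ := hσ j b
  refine ⟨fun ⟨u, hu⟩ => ⟨s⁻¹ * u, fun v hv => ?_⟩, fun ⟨u, hu⟩ => ⟨s * u, fun v hv => ?_⟩⟩
  · rw [← hu v hv, Pi.mul_apply, hs v hv, inv_mul_cancel_left]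
  · rw [Pi.mul_apply, hs v hv, hu v hv]

variable [DecidableEq V]

/-- The sign vector by which to multiply `ω` in order to multiply it by `θ j` on the middle block
of each good cell `j`. -/
def cellSign (block : ι → Fin 3 → Finset V) (θ : ι → ℤˣ) (ω : V → ℤˣ) (v : V) : ℤˣ :=
  ∏ j ∈ goodCells block ω, if v ∈ block j 1 then θ j else 1

theorem cellSign_eq_one {θ : ι → ℤˣ} {ω : V → ℤˣ} {v : V}
    (hv : ∀ j ∈ goodCells block ω, v ∉ block j 1) : cellSign block θ ω v = 1 :=
  Finset.prod_eq_one fun j hj => if_neg (hv j hj)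

namespace IsCellSystem

theorem cellSign_of_mem [DecidableEq ι] (h : IsCellSystem N block q) (θ : ι → ℤˣ) (ω : V → ℤˣ)
    {j : ι} {b : Fin 3} {v : V} (hv : v ∈ block j b) :
    cellSign block θ ω v = if j ∈ goodCells block ω ∧ b = 1 then θ j else 1 := by
  split_ifs with hj
  · obtain ⟨hj, rfl⟩ := hj
    rw [cellSign, Finset.prod_eq_single_of_mem j hj fun i _ hij =>
      if_neg fun hvi => hij (h.eq_of_mem hvi hv).1, if_pos hv]
  · refine cellSign_eq_one fun i hi hvi => hj ?_
    obtain ⟨rfl, rfl⟩ := h.eq_of_mem hvi hv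
    exact ⟨hi, rfl⟩

theorem exists_cellSign_eq (h : IsCellSystem N block q) (θ : ι → ℤˣ) (ω : V → ℤˣ) (j : ι)
    (b : Fin 3) : ∃ s, ∀ v ∈ block j b, cellSign block θ ω v = s := by
  classical exact ⟨_, fun v hv => h.cellSign_of_mem θ ω hv⟩

theorem iterate_cellSign_mul (h : IsCellSystem N block q) (θ : ι → ℤˣ) (ω : V → ℤˣ) (T : ℕ) :
    (majorityStep N)^[T] (cellSign block θ ω * ω) =
      cellSign block θ ω * (majorityStep N)^[T] ω := by
  refine iterate_majorityStep_mul (fun v => ?_) T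
  by_cases hv : ∃ j ∈ goodCells block ω, ∃ b, v ∈ block j b
  · obtain ⟨j, hj, b, hvb⟩ := hv
    exact Or.inl ⟨block j b, hvb, h.selfSupporting j b, mem_goodCells.mp hj b,
      h.exists_cellSign_eq θ ω j b⟩
  · push Not at hv
    refine Or.inr ⟨cellSign_eq_one fun j hj => hv j hj 1, fun w hw => cellSign_eq_one ?_⟩
    rintro j hj hwj
    obtain ⟨b, hb⟩ := h.exists_mem_of_mem hwj hw
    exact hv j hj b hb

variable [Fintype V]

theorem measurePreserving_cellSign_mul (h : IsCellSystem N block q) (θ : ι → ℤˣ) :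
    MeasurePreserving (fun ω => cellSign block θ ω * ω) (fairSigns V) (fairSigns V) := by
  have hinv : Function.Involutive fun ω => cellSign block θ ω * ω := fun ω => by
    have hsame : cellSign block θ (cellSign block θ ω * ω) = cellSign block θ ω := funext fun v =>
      Finset.prod_congr (goodCells_mul (h.exists_cellSign_eq θ ω) ω) fun _ _ => rfl
    funext v
    simp only [hsame, Pi.mul_apply, ← mul_assoc, Int.units_mul_self, one_mul]
  exact measurePreserving_fairSigns (hinv.toPerm _)

theorem exists_signSum_iterate_cellSign_mul (h : IsCellSystem N block q) (ω : V → ℤˣ) (T : ℕ) :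
    ∃ (c : ℤ) (u : ι → ℤˣ), ∀ θ,
      ∑ v, ((majorityStep N)^[T] (cellSign block θ ω * ω) v : ℤ) =
        c + q * ∑ j ∈ goodCells block ω, ((θ j * u j : ℤˣ) : ℤ) := by
  classical
  set X := (majorityStep N)^[T] ω with hX
  have hconst (j : ι) : ∃ u, j ∈ goodCells block ω → ∀ v ∈ block j 1, X v = u := by
    by_cases hj : j ∈ goodCells block ω
    · obtain ⟨u, hu⟩ := mem_goodCells.mp hj 1
      exact ⟨u, fun _ => (h.selfSupporting j 1).iterate_eq hu T⟩
    · exact ⟨1, fun hj' => absurd hj' hj⟩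
  choose u hu using hconst
  set middle := (goodCells block ω).biUnion fun j => block j 1
  refine ⟨∑ v ∈ middleᶜ, (X v : ℤ), u, fun θ => ?_⟩
  have hblock (j : ι) (hj : j ∈ goodCells block ω) :
      ∑ v ∈ block j 1, ((cellSign block θ ω v * X v : ℤˣ) : ℤ) = q * ((θ j * u j : ℤˣ) : ℤ) := by
    rw [← h.card_block j 1, ← nsmul_eq_mul]
    refine Finset.sum_eq_card_nsmul fun v hv => ?_
    rw [h.cellSign_of_mem θ ω hv, if_pos ⟨hj, rfl⟩, hu j hj v hv]
  have hdisj : ((goodCells block ω : Finset ι) : Set ι).PairwiseDisjoint fun j => block j 1 :=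
    fun i _ j _ hij => h.disjoint (i := (i, 1)) (j := (j, 1)) fun heq => hij (congrArg Prod.fst heq)
  rw [h.iterate_cellSign_mul, ← hX, ← Finset.sum_compl_add_sum middle, Finset.sum_biUnion hdisj,
    Finset.mul_sum]
  congr 1
  · refine Finset.sum_congr rfl fun v hv => ?_
    rw [Pi.mul_apply, cellSign_eq_one fun j hj hvj =>
      Finset.mem_compl.mp hv (Finset.mem_biUnion.mpr ⟨j, hj, hvj⟩), one_mul]
  · exact Finset.sum_congr rfl hblock

theorem pow_le_fairSigns_real_mem_goodCells (h : IsCellSystem N block q) (j : ι) :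
    (1 / 2) ^ (3 * q) ≤ (fairSigns V).real {ω | j ∈ goodCells block ω} := by
  have hcard : (Finset.univ.biUnion (block j)).card ≤ 3 * q := by
    simpa only [Finset.card_univ, Fintype.card_fin] using
      Finset.card_biUnion_le_card_mul Finset.univ (block j) q fun b _ => (h.card_block j b).le
  calc (1 / 2 : ℝ) ^ (3 * q) ≤ (1 / 2) ^ (Finset.univ.biUnion (block j)).card :=
        pow_le_pow_of_le_one (by norm_num) (by norm_num) hcard
    _ = (fairSigns V).real {ω | ∀ v ∈ Finset.univ.biUnion (block j), ω v = 1} :=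
        (fairSigns_real_forall_eq _ fun _ => 1).symm
    _ ≤ (fairSigns V).real {ω | j ∈ goodCells block ω} :=
        measureReal_mono fun ω hω => mem_goodCells.mpr fun b => ⟨1, fun v hv =>
          hω v (Finset.mem_biUnion.mpr ⟨b, Finset.mem_univ b, hv⟩)⟩

theorem fairSigns_real_card_goodCells_le [Nonempty ι] (h : IsCellSystem N block q) :
    (fairSigns V).real
        {ω | ((goodCells block ω).card : ℝ) ≤ (1 / 2) ^ (3 * q) * Fintype.card ι / 2} ≤
      1 / (((1 / 2) ^ (3 * q)) ^ 2 * Fintype.card ι) := by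
  refine fairSigns_real_card_le (J := goodCells block)
    (S := fun j => Finset.univ.biUnion (block j)) (fun j ω ω' hωω' => ?_) (fun i j hij => ?_)
    (by positivity) h.pow_le_fairSigns_real_mem_goodCells
  · simp only [mem_goodCells]
    refine propext (forall_congr' fun b => exists_congr fun u => forall₂_congr fun v hv => ?_)
    rw [hωω' v (Finset.mem_biUnion.mpr ⟨b, Finset.mem_univ b, hv⟩)]
  · simp only [Function.onFun, Finset.disjoint_biUnion_left, Finset.disjoint_biUnion_right]
    exact fun a _ b _ => h.disjoint (i := (i, _)) (j := (j, _)) fun heq =>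
      hij (congrArg Prod.fst heq)

theorem fairSigns_real_abs_signSum_iterate_le [Nonempty ι] (h : IsCellSystem N block q)
    (hq : q ≠ 0) (T r : ℕ) :
    (fairSigns V).real {ω | |∑ v, ((majorityStep N)^[T] ω v : ℤ)| ≤ r} ≤
      1 / (((1 / 2) ^ (3 * q)) ^ 2 * Fintype.card ι) +
        (2 * r + 1) / √((1 / 2) ^ (3 * q) * Fintype.card ι / 2) := by
  classical
  refine (measureReal_le_add_of_measurePreserving (ν := fairSigns ι)
    h.measurePreserving_cellSign_mul (c := (2 * r + 1) / √((1 / 2) ^ (3 * q) * Fintype.card ι / 2))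
    (by positivity) fun ω hω => ?_).trans (add_le_add_left h.fairSigns_real_card_goodCells_le _)
  have hmany : (1 / 2 : ℝ) ^ (3 * q) * Fintype.card ι / 2 < (goodCells block ω).card := not_le.mp hω
  have hnonempty : (goodCells block ω).Nonempty :=
    Finset.card_pos.mp (Nat.cast_pos.mp (lt_of_le_of_lt (by positivity) hmany))
  obtain ⟨c, u, hsum⟩ := h.exists_signSum_iterate_cellSign_mul ω T
  simp only [Set.mem_ofPred_eq, hsum]
  calc (fairSigns ι).real {θ | |c + q * ∑ j ∈ goodCells block ω, ((θ j * u j : ℤˣ) : ℤ)| ≤ r}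
      ≤ (2 * r + 1) / √(goodCells block ω).card :=
        fairSigns_real_abs_add_signSum_le hnonempty u c (Nat.cast_ne_zero.mpr hq) r
    _ ≤ (2 * r + 1) / √((1 / 2) ^ (3 * q) * Fintype.card ι / 2) := by gcongr

end IsCellSystem

end Cells

/-! ### Anticoncentration on the cycle -/

/-- The `c`-th of the consecutive blocks of `k + 1` sites of the `n`-cycle, counted from site `0`.
The sites are written `0 + d` to match `cycleChildren_add_intCast`. -/
noncomputable def cycleBlock (k n c : ℕ) : Finset (ZMod n) :=
  (Finset.Icc (c * (k + 1) : ℤ) (c * (k + 1) + k)).image fun d : ℤ => 0 + (d : ZMod n)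

section CycleBlock

variable {k n : ℕ}

theorem selfSupporting_cycleBlock (hkn : k < n) (c : ℕ) :
    SelfSupporting (cycleChildren k n) (cycleBlock k n c) := by
  refine (selfSupporting_Icc k _).image (fun x _ => cycleChildren_add_intCast k n 0 x) ?_
  rw [Finset.coe_Icc]
  exact injOn_add_intCast (by omega) 0

theorem card_cycleBlock (hkn : k < n) (c : ℕ) : (cycleBlock k n c).card = k + 1 := by
  rw [cycleBlock, Finset.card_image_of_injOn, Int.card_Icc]
  · omega
  · rw [Finset.coe_Icc]
    exact injOn_add_intCast (by omega) 0

theorem disjoint_cycleBlock {c c' : ℕ} (hcc' : c ≠ c') (hc : (c + 1) * (k + 1) ≤ n)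
    (hc' : (c' + 1) * (k + 1) ≤ n) : Disjoint (cycleBlock k n c) (cycleBlock k n c') := by
  wlog hlt : c < c' generalizing c c'
  · exact (this hcc'.symm hc' hc (by omega)).symm
  have hsep : ((c : ℤ) + 1) * (k + 1) ≤ c' * (k + 1) := by exact_mod_cast Nat.mul_le_mul_right _ hlt
  have : ((c' : ℤ) + 1) * (k + 1) ≤ n := by exact_mod_cast hc'
  have hstart : (0 : ℤ) ≤ c * (k + 1) := by positivity
  rw [Finset.disjoint_left, cycleBlock, Finset.forall_mem_image]
  intro x hx hx'
  obtain ⟨y, hy, hyx⟩ := Finset.mem_image.mp hx'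
  rw [Finset.mem_Icc] at hx hy
  have := injOn_add_intCast (n := n) (a := c * (k + 1)) (b := c' * (k + 1) + k) (by linarith) 0
    ⟨by linarith, hy.2⟩ ⟨hx.1, by linarith⟩ hyx
  linarith

theorem exists_mem_cycleBlock_of_mem {c : ℕ} {v w : ZMod n} (hw : w ∈ cycleBlock k n (c + 1))
    (hv : w ∈ cycleChildren k n v) : ∃ b : Fin 3, v ∈ cycleBlock k n (c + b) := by
  obtain ⟨x, hx, rfl⟩ := Finset.mem_image.mp hw
  rw [mem_cycleChildren_comm, cycleChildren_add_intCast] at hv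
  obtain ⟨y, hy, rfl⟩ := Finset.mem_image.mp hv
  rw [Finset.mem_Icc] at hx hy
  push_cast at hx
  have hmem (b : ℕ) (hb : b < 3) (hby : (c + b) * (k + 1) ≤ y)
      (hyb : y ≤ (c + b) * (k + 1) + k) : ∃ b : Fin 3, 0 + (y : ZMod n) ∈ cycleBlock k n (c + b) :=
    ⟨⟨b, hb⟩, Finset.mem_image_of_mem _ (by rw [Finset.mem_Icc]; push_cast; exact ⟨hby, hyb⟩)⟩
  rcases lt_or_ge y ((c + 1) * (k + 1)) with hy₁ | hy₁
  · exact hmem 0 (by norm_num) (by push_cast; linarith) (by push_cast; linarith)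
  rcases lt_or_ge y ((c + 2) * (k + 1)) with hy₂ | hy₂
  · exact hmem 1 (by norm_num) (by push_cast; linarith) (by push_cast; linarith)
  · exact hmem 2 (by norm_num) (by push_cast; linarith) (by push_cast; linarith)

theorem isCellSystem_cycleBlock {m : ℕ} (hmn : 3 * m * (k + 1) ≤ n) :
    IsCellSystem (cycleChildren k n) (fun (j : Fin m) (b : Fin 3) => cycleBlock k n (3 * j + b))
      (k + 1) := by
  have hfit (j : Fin m) (b : Fin 3) : (3 * j + b + 1 : ℕ) * (k + 1) ≤ n :=
    (Nat.mul_le_mul_right _ (by omega)).trans hmn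
  have hkn (j : Fin m) : k < n :=
    (Nat.le_mul_of_pos_left (k + 1) (Nat.succ_pos _)).trans (hfit j 0)
  refine ⟨fun j b => selfSupporting_cycleBlock (hkn j) _, fun j b => card_cycleBlock (hkn j) _,
    fun i j hij => disjoint_cycleBlock (fun heq => hij ?_) (hfit _ _) (hfit _ _),
    exists_mem_cycleBlock_of_mem⟩
  exact Prod.ext (Fin.ext (by omega)) (Fin.ext (by omega))

theorem exists_fairSigns_real_abs_signSum_iterate_cycleStep_le_add (k : ℕ) : ∃ b c : ℝ, 0 < c ∧
    ∀ (n : ℕ) [NeZero n], 3 * (k + 1) ≤ n → ∀ T r : ℕ,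
      (fairSigns (ZMod n)).real {ω | |∑ i, ((cycleStep k n)^[T] ω i : ℤ)| ≤ r} ≤
        b / n + (2 * r + 1) / (c * √n) := by
  set p : ℝ := (1 / 2) ^ (3 * (k + 1))
  set L : ℝ := 6 * (k + 1) with hL
  have hp0 : 0 < p := by positivity
  have hL0 : 0 < L := by positivity
  refine ⟨L / p ^ 2, √(p / (2 * L)), by positivity, fun n _ hn T r => ?_⟩
  have hn0 : (0 : ℝ) < n := Nat.cast_pos.mpr (NeZero.pos n)
  set m := n / (3 * (k + 1)) with hm
  have hmn : 3 * m * (k + 1) ≤ n := by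
    rw [mul_right_comm]; exact Nat.mul_div_le n _
  have hm0 : 0 < m := Nat.div_pos hn (by positivity)
  have hnm : (n : ℝ) / L ≤ m := by
    have hlt := Nat.lt_mul_div_succ n (show 0 < 3 * (k + 1) by positivity)
    have hle : n ≤ m * (6 * (k + 1)) := by nlinarith
    rw [div_le_iff₀ hL0, hL]
    exact_mod_cast hle
  have : Nonempty (Fin m) := ⟨⟨0, hm0⟩⟩
  calc (fairSigns (ZMod n)).real {ω | |∑ i, ((cycleStep k n)^[T] ω i : ℤ)| ≤ r}
      ≤ 1 / (p ^ 2 * m) + (2 * r + 1) / √(p * m / 2) := by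
        have hcells := isCellSystem_cycleBlock hmn
        have hle := hcells.fairSigns_real_abs_signSum_iterate_le (Nat.succ_ne_zero k) T r
        rwa [Fintype.card_fin] at hle
    _ ≤ 1 / (p ^ 2 * (n / L)) + (2 * r + 1) / √(p * (n / L) / 2) := by gcongr
    _ = L / p ^ 2 / n + (2 * r + 1) / (√(p / (2 * L)) * √n) := by
        rw [← Real.sqrt_mul (by positivity)]
        congr 1
        · field_simp
        · congr 2
          field_simp

theorem exists_fairSigns_real_abs_signSum_iterate_cycleStep_le (k : ℕ) {a : ℝ} (ha : 0 < a) :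
    ∃ δ > 0, ∃ M : ℕ, ∀ n [NeZero n], M ≤ n → ∀ T,
      (fairSigns (ZMod n)).real
        {ω | ((|∑ i, ((cycleStep k n)^[T] ω i : ℤ)| : ℤ) : ℝ) ≤ δ * √n} ≤ a := by
  obtain ⟨b, c, hc, hbound⟩ := exists_fairSigns_real_abs_signSum_iterate_cycleStep_le_add k
  have hlim : Tendsto (fun n : ℕ => b / (n : ℝ) + 1 / c / √n) atTop (𝓝 (0 + 0)) :=
    (tendsto_const_div_atTop_nhds_zero_nat b).add
      (tendsto_const_nhds.div_atTop (Real.tendsto_sqrt_atTop.comp tendsto_natCast_atTop_atTop))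
  rw [add_zero] at hlim
  obtain ⟨M, hM⟩ := eventually_atTop.1 (hlim.eventually_le_const (half_pos ha))
  refine ⟨a * c / 4, by positivity, max M (3 * (k + 1)), fun n _ hn T => ?_⟩
  have hn0 : (0 : ℝ) < n := Nat.cast_pos.mpr (NeZero.pos n)
  set r := ⌊a * c / 4 * √n⌋₊
  calc (fairSigns (ZMod n)).real
        {ω | ((|∑ i, ((cycleStep k n)^[T] ω i : ℤ)| : ℤ) : ℝ) ≤ a * c / 4 * √n}
      ≤ (fairSigns (ZMod n)).real {ω | |∑ i, ((cycleStep k n)^[T] ω i : ℤ)| ≤ r} := by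
        refine measureReal_mono fun ω hω => ?_
        rw [Set.mem_ofPred_eq, Int.natCast_floor_eq_floor (by positivity)]
        exact Int.le_floor.mpr hω
    _ ≤ b / n + (2 * r + 1) / (c * √n) := hbound n (le_of_max_le_right hn) T r
    _ ≤ b / n + (2 * (a * c / 4 * √n) + 1) / (c * √n) := by
        gcongr
        exact Nat.floor_le (by positivity)
    _ = (b / n + 1 / c / √n) + a / 2 := by field_simp; ring
    _ ≤ a := by linarith [hM n (le_of_max_le_left hn)]

end CycleBlock

/-! ### The cycle -/

section Cycle

open ProbabilityTheory

variable {k n T : ℕ} [NeZero n]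

theorem abs_signSum_le_abs_sum_siteChange {η ω : ZMod n → ℤˣ}
    (h : cycleMajority k T n ω ≠ cycleMajority k T n (ω * η)) :
    ((|∑ i, ((cycleStep k n)^[T] ω i : ℤ)| : ℤ) : ℝ) ≤ |∑ i, siteChange k T η i ω| := by
  have hle := abs_signSum_le_of_majorityOn_ne h
  simp only [siteChange, noiseChange]
  exact_mod_cast hle

theorem changeProb_cycleMajority_le (k T : ℕ) (η : ZMod n → ℤˣ) {R : ℝ} (hR : 0 < R) :
    changeProb (cycleMajority k T n) η ≤
      (fairSigns (ZMod n)).real {ω | ((|∑ i, ((cycleStep k n)^[T] ω i : ℤ)| : ℤ) : ℝ) ≤ R} +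
        Var[fun ω => ∑ i, siteChange k T η i ω; fairSigns (ZMod n)] / R ^ 2 := by
  set D := fun ω => ∑ i, siteChange k T η i ω
  have hmean : ∫ ω, D ω ∂fairSigns (ZMod n) = 0 := by
    rw [integral_finsetSum _ fun _ _ => .of_finite]
    exact Finset.sum_eq_zero fun i _ => integral_noiseChange _ η
  have hcheb := meas_ge_le_variance_div_sq (μ := fairSigns (ZMod n)) (X := D) .of_discrete hR
  simp only [hmean, sub_zero] at hcheb
  calc changeProb (cycleMajority k T n) η
      ≤ (fairSigns (ZMod n)).real
          ({ω | ((|∑ i, ((cycleStep k n)^[T] ω i : ℤ)| : ℤ) : ℝ) ≤ R} ∪ {ω | R ≤ |D ω|}) :=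
        measureReal_mono fun ω hω => (le_total _ R).imp id fun hR' =>
          hR'.trans (abs_signSum_le_abs_sum_siteChange hω)
    _ ≤ _ := measureReal_union_le _ _
    _ ≤ _ := add_le_add_right (ENNReal.toReal_le_of_le_ofReal
        (div_nonneg (variance_nonneg _ _) (by positivity)) hcheb) _

theorem exists_changeProb_cycleMajority_le (k : ℕ) {a : ℝ} (ha : 0 < a) : ∃ C : ℝ, ∃ M : ℕ,
    ∀ n [NeZero n], M ≤ n → ∀ T η,
      changeProb (cycleMajority k T n) η ≤ a + C / n * flipCount Finset.univ η := by
  obtain ⟨δ, hδ, M₁, hsmall⟩ :=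
    exists_fairSigns_real_abs_signSum_iterate_cycleStep_le k (half_pos ha)
  obtain ⟨C, M₂, hvar⟩ := exists_variance_sum_siteChange_le k (a := a / 2 * δ ^ 2) (by positivity)
  refine ⟨C / δ ^ 2, max M₁ M₂, fun n _ hn T η => ?_⟩
  have hn0 : (0 : ℝ) < n := Nat.cast_pos.mpr (NeZero.pos n)
  calc changeProb (cycleMajority k T n) η
      ≤ a / 2 + (a / 2 * δ ^ 2 * n + C * flipCount Finset.univ η) / (δ * √n) ^ 2 := by
        refine (changeProb_cycleMajority_le k T η (R := δ * √n) (by positivity)).trans ?_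
        gcongr
        exacts [hsmall n (le_of_max_le_left hn) T, hvar n (le_of_max_le_right hn) T η]
    _ = a + C / δ ^ 2 / n * flipCount Finset.univ η := by
        rw [mul_pow, Real.sq_sqrt hn0.le]
        field_simp
        ring

theorem noiseStable_cycleMajority (k : ℕ) (T : ℕ → ℕ) :
    NoiseStable fun n : {n : ℕ // Odd n} => cycleMajority k (T n) (n : ℕ) := by
  refine noiseStable_of_changeProb_le fun a ha => ?_
  obtain ⟨C, M, hlarge⟩ := exists_changeProb_cycleMajority_le k ha
  refine ⟨max C M, fun n => ?_⟩
  have hcard : (Finset.univ : Finset (ZMod n)).card = (n : ℕ) := ZMod.card n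
  rcases le_total M n with hMn | hnM
  · refine ⟨Finset.univ, C / (n : ℕ), ?_, hlarge n hMn (T n)⟩
    have hn0 : ((n : ℕ) : ℝ) ≠ 0 := Nat.cast_ne_zero.mpr (NeZero.ne _)
    rw [hcard, div_mul_cancel₀ _ hn0]
    exact le_max_left _ _
  · refine ⟨Finset.univ, 1, ?_, fun η => ?_⟩
    · rw [hcard, one_mul]
      exact le_max_of_le_right (by exact_mod_cast hnM)
    · rw [one_mul]
      refine changeProb_le_add_flipCount ha.le fun hη => ?_
      obtain rfl : η = 1 := funext fun x => hη x (Finset.mem_univ x)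
      simpa [changeProb] using ha.le

end Cycle

theorem mainTheorem12 (k : ℕ) (hk : 1 ≤ k) :
    NoiseStable (fun n : ℕ => treeMajority k n) ∧
      ∀ T : ℕ → ℕ, NoiseStable (fun n : {n : ℕ // Odd n} => cycleMajority k (T n) (n : ℕ)) :=
  ⟨noiseStable_treeMajority k, fun T => noiseStable_cycleMajority k T⟩
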